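/- **Theorem 1.1.** Let $1\le q_1\le q_2\le\cdots$ be an infinite sequence of real numbers such that, for some constants $\alpha,\beta>0$, $A\ge 0$ and $B>\max\{A,1\}$, with $\beta'=(2+\beta)^2$, $$\#\{n: q_n\le x\}=\alpha\int_{\beta'}^x\big(\log(t/\beta)\big)^{A-1}\Big(1+O\Big(\frac1{(\log t)^B}\Big)\Big)\,dt\qquad\text{for all }x\ge 2\beta'.$$ Then there is a constant $C_{\mathcal A}$ such that, as $y\to\infty$, $$\sum_{q_n\le y}\frac1{q_n}=\begin{cases}\frac{\alpha}{A}(\log (y/\beta))^A+C_{\mathcal A}+o(1)&\text{if }A>0,\\ \alpha\log\log (y/\beta)+C_{\mathcal A}+o(1)&\text{if }A=0.\end{cases}$$ For $V\ge 1+C_{\mathcal A}$ put $W=W(V)=\big(\frac A\alpha(V-C_{\mathcal A})\big)^{1/A}$ if $A>0$ and $W=W(V)=\exp\big(\frac1\alpha(V-C_{\mathcal A})\big)$ if $A=0$. Let $\{\mathbb Y(n)\}_{n\ge1}$ be independent real random variables satisfying the hypothesis CRVH$(\mathbb Y)$ for a real random variable $\mathbb Y$, with constants $c_1,c_2,c_3>0$,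 that is: * each $\mathbb Y(n)$ is supported on $[-1,1]$ and $\mathbb E(\mathbb Y(n))=0$; * $\mathbb P(\mathbb Y(n)>1-1/t)\ge c_2\exp(-c_1e^{\sqrt t})$ for all $n\ge1$ and all real $t\ge1$; * there are independent random variables $\{\mathbb Y_n\}_{n\ge1}$, each distributed identically to $\mathbb Y$ and defined on the same probability space as the $\mathbb Y(n)$, such that almost surely $|\mathbb Y(n)-\mathbb Y_n|\le c_3/(\log n)^2$ for all $n\ge2$. Let $f_{\mathbb Y}(t)=\log\mathbb E(e^{t\mathbb Y})$ for $0\le t<1$ and $f_{\mathbb Y}(t)=\log\mathbb E(e^{t\mathbb Y})-t$ for $t\ge1$. Then the integral $\eta_{\mathbb Y}=\int_0^\infty \frac{f_{\mathbb Y}(u)}{u^2}\,du$ converges absolutely. Moreover there are constants $\Theta'>0$ and $c\ge1$ such that, for all sufficiently large $Q$, $$\mathbb P\Big(\sum_{q_n\le Q}\frac{\mathbb Y(n)}{q_n}>V\Big)=\exp\left(-\alpha\beta e^{-\eta_{\mathbb Y}-1}W^{A-1}e^W\left(1+O\left(\frac{\sqrt{\log W}}{W^{1/2}}+\frac1{W^{(B-1)/2}}\right)\right)\right)$$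 uniformly for all $V\ge 1+C_{\mathcal A}$ with $$c\le W=W(V)\le\log Q-\log\log Q-\Theta'.$$ Here $\Theta'$, $c$, the implied constant and the lower bound on $Q$ depend only on the sequence $(q_n)$ (with its parameters $\alpha,\beta,A,B$) and on $c_1,c_2,c_3$. -/

import Mathlib

open MeasureTheory ProbabilityTheory Filter Topology

noncomputable section

namespace LargeDev

/-- The counting function `𝒜(x) = #{n : q_n ≤ x}` of a sequence `(q_n)_{n ≥ 1}`. -/
def count (q : ℕ+ → ℝ) (x : ℝ) : ℕ := Set.ncard {n : ℕ+ | q n ≤ x}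

/-- The harmonic sum `H(x) = ∑_{q_n ≤ x} 1 / q_n`. -/
def harmonicSum (q : ℕ+ → ℝ) (x : ℝ) : ℝ := ∑ᶠ (n : ℕ+) (_ : q n ≤ x), 1 / q n

/-- `1 ≤ q_1 ≤ q_2 ≤ …` is an infinite sequence whose counting function satisfies
`𝒜(x) = α ∫_{β'}^x (log (t/β))^{A-1} (1 + O(1/(log t)^B)) dt` for `x ≥ 2β'`, with
`β' = (2+β)^2`, where `α, β > 0`, `A ≥ 0` and `B > max {A, 1}`. -/
structure IsWeightSequence (q : ℕ+ → ℝ) (α β A B : ℝ) : Prop where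
  one_le : ∀ n, 1 ≤ q n
  mono : Monotone q
  finite : ∀ x : ℝ, {n : ℕ+ | q n ≤ x}.Finite
  alpha_pos : 0 < α
  beta_pos : 0 < β
  A_nonneg : 0 ≤ A
  lt_B : max A 1 < B
  asymp : ∃ C : ℝ, ∀ x : ℝ, 2 * (2 + β) ^ 2 ≤ x →
    |(count q x : ℝ) - α * ∫ t in ((2 + β) ^ 2)..x, Real.log (t / β) ^ (A - 1)| ≤
      C * (α * ∫ t in ((2 + β) ^ 2)..x, Real.log (t / β) ^ (A - 1) / Real.log t ^ B)

/-- The main term of `H(y)`: `(α/A) (log (y/β))^A` if `A > 0`, `α log log (y/β)` if `A = 0`. -/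
def harmonicMain (α β A y : ℝ) : ℝ :=
  if A = 0 then α * Real.log (Real.log (y / β)) else α / A * Real.log (y / β) ^ A

/-- `W(V)`, to be used for `V ≥ 1 + C_𝒜` only; `CA` stands for the constant `C_𝒜`. -/
def W (α A CA V : ℝ) : ℝ :=
  if A = 0 then Real.exp ((V - CA) / α) else (A / α * (V - CA)) ^ (1 / A)

/-- The hypothesis `CRVH(𝕐)` with explicit constants: `c₁` is the constant in the exponent and
`c₂` the implicit constant in the lower bound `P(Y(n) > 1 - 1/t) ≫ exp(-c₁ e^{√t})`, and `c₃` is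
the implicit constant in `Y(n) = 𝕐_n + O(1/(log n)^2)` (which says nothing for `n = 1`). -/
structure CRVH {Ω Ω' : Type*} [MeasurableSpace Ω] [MeasurableSpace Ω']
    (P : Measure Ω) (P' : Measure Ω') (Y : ℕ+ → Ω → ℝ) (Ylim : Ω' → ℝ)
    (c₁ c₂ c₃ : ℝ) : Prop where
  measurable : ∀ n, Measurable (Y n)
  measurable_lim : Measurable Ylim
  indep : iIndepFun Y P
  supported : ∀ n, ∀ᵐ ω ∂P, Y n ω ∈ Set.Icc (-1 : ℝ) 1
  mean_zero : ∀ n, ∫ ω, Y n ω ∂P = 0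
  lower : ∀ n, ∀ t : ℝ, 1 ≤ t →
    c₂ * Real.exp (-c₁ * Real.exp (Real.sqrt t)) ≤ P.real {ω | 1 - 1 / t < Y n ω}
  approx : ∃ Y' : ℕ+ → Ω → ℝ, (∀ n, Measurable (Y' n)) ∧ iIndepFun Y' P ∧
    (∀ n, IdentDistrib (Y' n) Ylim P P') ∧
    ∀ n : ℕ+, 2 ≤ n → ∀ᵐ ω ∂P, |Y n ω - Y' n ω| ≤ c₃ / Real.log (n : ℝ) ^ 2

/-- `f_X(t) = log E(e^{tX})` for `t < 1` and `log E(e^{tX}) - t` for `t ≥ 1`. -/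
def f {Ω : Type*} [MeasurableSpace Ω] (P : Measure Ω) (X : Ω → ℝ) (t : ℝ) : ℝ :=
  if t < 1 then Real.log (∫ ω, Real.exp (t * X ω) ∂P)
  else Real.log (∫ ω, Real.exp (t * X ω) ∂P) - t

/-- `η_X = ∫_0^∞ f_X(u) / u^2 du`. -/
def eta {Ω : Type*} [MeasurableSpace Ω] (P : Measure Ω) (X : Ω → ℝ) : ℝ :=
  ∫ u in Set.Ioi (0 : ℝ), f P X u / u ^ 2

/-- `Φ_Q(Y, V) = P(∑_{q_n ≤ Q} Y(n) / q_n > V)`. -/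
def Phi {Ω : Type*} [MeasurableSpace Ω] (P : Measure Ω) (q : ℕ+ → ℝ) (Y : ℕ+ → Ω → ℝ)
    (Q V : ℝ) : ℝ :=
  P.real {ω | V < ∑ᶠ (n : ℕ+) (_ : q n ≤ Q), Y n ω / q n}

end LargeDev

end

/-!
The probability is found from the Laplace transform of `S = ∑_{q_n ≤ Q} Y(n) / q_n`. By
independence `log E e^{sS}` is `∑_{q_n ≤ Q} g_n(s / q_n)`, where `g_n` is the cumulant generating
function of `Y(n)`. Now `g_n(t)` is close to `t` for large `t`, because `Y(n)` comes close to its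
maximum `1` with a probability that is not too small (`sub_cgf_le_of_lower`), and it is at most
`t²`, because `Y(n)` has mean zero. So the terms with `q_n ≤ s` add up to about `s` times the
harmonic sum up to `s`, and the correction comes from the `q_n` near `s`, where `g_n` may be
replaced by the cumulant generating function of the limit and the sum by an integral; the
substitution `u = s / t` turns it into `α η s log(s/β)^{A-1}`. This gives
(`IsWeightSequence.exists_laplace_asymptotic`)

  `log E e^{sS} = s (main(s) + C_𝒜) + α η s log(s/β)^{A-1} + error`,

where `main(s) = harmonicMain α β A s`. The relative error `log w / w + w^{1-B}`, `w = log s`, has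
two sources: the variation of `log(t/β)^{A-1}` around `t = s`, and partial summation with the given
counting function (`IsWeightSequence.exists_sum_block_sub_integral_le`). The latter, applied to
`1/t`, also yields the constant `C_𝒜`. The upper bound for `W` says that `s log s ≤ Q`, so that the
truncation at `Q` is harmless.

As `V = main(β e^W) + C_𝒜`, the exponent at `s = β e^{W + τ}` is
`log E e^{sS} - s V ≈ M e^τ (τ + η)` with `M = α β e^W W^{A-1}`
(`IsWeightSequence.exists_exponent_asymptotic`). Its minimum `-M e^{-η-1}` is attained at
`τ = -η - 1`, and Chernoff's inequality there is the upper bound. For the lower bound the measure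
is tilted at `τ = -η - 1 + κ`. The exponents at `-η - 1` and `-η - 1 + 2κ` show that under the
tilted measure `S` is just above `V` with probability at least `1/2`, as soon as `κ²` exceeds a
multiple of the relative error (`exists_prob_eq_exp`); this is where the square root in the final
error comes from. All constants depend on the random variables only through the bounds collected
in `CumulantBounds`.
-/

namespace LargeDev

/-! ### Elementary inequalities for powers and logarithms -/

/-- Powers of two quantities of the same order of magnitude are comparable, whatever the sign of
the exponent. -/
lemma rpow_le_mul_rpow {x y k : ℝ} (p : ℝ) (hx : 0 < x) (hy : 0 < y) (hk : 1 ≤ k)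
    (h₁ : x ≤ k * y) (h₂ : y ≤ k * x) : x ^ p ≤ k ^ |p| * y ^ p := by
  have hk0 : 0 < k := by linarith
  rcases le_total 0 p with hp | hp
  · rw [abs_of_nonneg hp, ← Real.mul_rpow hk0.le hy.le]
    exact Real.rpow_le_rpow hx.le h₁ hp
  · rw [abs_of_nonpos hp]
    have h3 : y / k ≤ x := by
      rw [div_le_iff₀ hk0]; linarith
    calc x ^ p ≤ (y / k) ^ p := Real.rpow_le_rpow_of_nonpos (by positivity) h3 hp
      _ = k ^ (-p) * y ^ p := by
        rw [Real.div_rpow hy.le hk0.le, Real.rpow_neg hk0.le]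
        field_simp

lemma one_le_log {t : ℝ} (ht : 4 ≤ t) : 1 ≤ Real.log t := by
  rw [Real.le_log_iff_exp_le (by linarith)]
  linarith [Real.exp_one_lt_d9]

/-- A positive power of the logarithm varies more slowly than a square root. -/
lemma exists_log_rpow_le {r : ℝ} (hr : 0 ≤ r) :
    ∃ C : ℝ, 0 < C ∧ ∀ t x : ℝ, 4 ≤ t → t ≤ x →
      Real.log x ^ r ≤ C * Real.log t ^ r * Real.sqrt (x / t) := by
  -- `1 + log y ≪ y^e` with `e r ≤ 1/2`.
  set e : ℝ := 1 / (2 * (r + 1)) with he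
  have he0 : 0 < e := by positivity
  have he1 : e ≤ 1 := by
    rw [he, div_le_one (by positivity)]; linarith
  refine ⟨(1 / e) ^ r, by positivity, fun t x ht hx => ?_⟩
  have hlt := one_le_log ht
  have ht0 : 0 < t := by linarith
  have hx0 : 0 < x := by linarith
  set y := x / t with hy
  have hy1 : 1 ≤ y := by rw [hy, one_le_div ht0]; exact hx
  have hy0 : 0 < y := by linarith
  have hlx : Real.log x = Real.log t + Real.log y := by
    rw [hy, Real.log_div hx0.ne' ht0.ne']; ring
  have hly : 0 ≤ Real.log y := Real.log_nonneg hy1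
  have h1 : 1 + Real.log y ≤ 1 / e * y ^ e := by
    have h2 : Real.log (y ^ e) ≤ y ^ e - 1 := Real.log_le_sub_one_of_pos (by positivity)
    rw [Real.log_rpow hy0] at h2
    have h3 : Real.log y ≤ (y ^ e - 1) / e := by
      rw [le_div_iff₀ he0]; linarith
    have h4 : 1 ≤ 1 / e := by rw [one_le_div he0]; exact he1
    calc 1 + Real.log y ≤ 1 + (y ^ e - 1) / e := by linarith
      _ = 1 / e * y ^ e + (1 - 1 / e) := by ring
      _ ≤ _ := by linarith
  have h5 : Real.log x ≤ Real.log t * (1 / e * y ^ e) := by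
    calc Real.log x ≤ Real.log t * (1 + Real.log y) := by
          rw [hlx]; nlinarith
      _ ≤ _ := by gcongr
  have h6 : (y ^ e) ^ r ≤ Real.sqrt y := by
    rw [← Real.rpow_mul hy0.le, Real.sqrt_eq_rpow]
    apply Real.rpow_le_rpow_of_exponent_le hy1
    rw [he, div_mul_eq_mul_div, div_le_div_iff₀ (by positivity) (by norm_num)]
    linarith
  calc Real.log x ^ r ≤ (Real.log t * (1 / e * y ^ e)) ^ r :=
        Real.rpow_le_rpow (by linarith) h5 hr
    _ = (1 / e) ^ r * Real.log t ^ r * (y ^ e) ^ r := by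
        rw [Real.mul_rpow (by linarith) (by positivity), Real.mul_rpow (by positivity)
          (by positivity)]
        ring
    _ ≤ _ := by gcongr

/-- For `t ≥ β' = (2 + β)²` the logarithms of `t / β` and `t` have the same order. -/
lemma log_div_bounds {β t : ℝ} (hβ : 0 < β) (ht : (2 + β) ^ 2 ≤ t) :
    4 ≤ t ∧ 1 ≤ Real.log t ∧ Real.log t ≤ 2 * Real.log (t / β) ∧
      Real.log (t / β) ≤ (2 + |Real.log β|) * Real.log t := by
  have h4 : 4 ≤ t := by nlinarith
  have hl := one_le_log h4
  have ht0 : 0 < t := by linarith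
  refine ⟨h4, hl, ?_, ?_⟩
  · rw [Real.log_div ht0.ne' hβ.ne']
    have : Real.log (β ^ 2) ≤ Real.log t := Real.log_le_log (by positivity) (by nlinarith)
    rw [Real.log_pow] at this
    push_cast at this
    linarith
  · rw [Real.log_div ht0.ne' hβ.ne']
    have := neg_abs_le (Real.log β)
    nlinarith [abs_nonneg (Real.log β)]

/-- The density `log(t/β)^p` and `(log t)^p` are comparable for `t ≥ β'`. -/
lemma exists_log_div_rpow_comparable {β : ℝ} (hβ : 0 < β) (p : ℝ) :
    ∃ K : ℝ, 1 ≤ K ∧ ∀ t : ℝ, (2 + β) ^ 2 ≤ t →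
      Real.log (t / β) ^ p ≤ K * Real.log t ^ p ∧ Real.log t ^ p ≤ K * Real.log (t / β) ^ p := by
  refine ⟨(2 + |Real.log β|) ^ |p|, Real.one_le_rpow (by linarith [abs_nonneg (Real.log β)])
    (abs_nonneg _), fun t ht => ?_⟩
  obtain ⟨h4, h1, h2, h3⟩ := log_div_bounds hβ ht
  have hk : 1 ≤ 2 + |Real.log β| := by linarith [abs_nonneg (Real.log β)]
  have h2' : Real.log t ≤ (2 + |Real.log β|) * Real.log (t / β) := by
    nlinarith [abs_nonneg (Real.log β)]
  have h0 : 0 < Real.log (t / β) := by linarith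
  exact ⟨rpow_le_mul_rpow p h0 (by linarith) hk h3 h2',
    rpow_le_mul_rpow p (by linarith) h0 hk h2' h3⟩

lemma log_div_pos {β t : ℝ} (hβ : 0 < β) (ht : (2 + β) ^ 2 ≤ t) : 0 < Real.log (t / β) := by
  obtain ⟨-, h1, h2, -⟩ := log_div_bounds hβ ht
  linarith

lemma continuousOn_log_div_rpow {β : ℝ} (hβ : 0 < β) (p : ℝ) :
    ContinuousOn (fun t : ℝ => Real.log (t / β) ^ p) (Set.Ici ((2 + β) ^ 2)) := by
  intro t ht
  have h0 := log_div_pos hβ ht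
  have ht0 : 0 < t := by have := (log_div_bounds hβ ht).1; linarith
  apply ContinuousAt.continuousWithinAt
  refine ContinuousAt.rpow_const (f := fun t : ℝ => Real.log (t / β)) ?_ (Or.inl h0.ne')
  exact ContinuousAt.log (by fun_prop) (by positivity)

lemma continuousOn_log_rpow (p : ℝ) :
    ContinuousOn (fun t : ℝ => Real.log t ^ p) (Set.Ici 4) := by
  intro t ht
  have h0 := one_le_log ht
  have ht0 : (4 : ℝ) ≤ t := ht
  apply ContinuousAt.continuousWithinAt
  apply ContinuousAt.rpow_const _ (Or.inl (by linarith))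
  exact Real.continuousAt_log (by linarith)

/-- The derivative of the main term `H(y)` is `α log(y/β)^{A-1} / y`. -/
lemma hasDerivAt_harmonicMain {α β A t : ℝ} (hβ : 0 < β) (ht : (2 + β) ^ 2 ≤ t) :
    HasDerivAt (harmonicMain α β A) (α * Real.log (t / β) ^ (A - 1) / t) t := by
  have h0 := log_div_pos hβ ht
  have ht0 : 0 < t := by have := (log_div_bounds hβ ht).1; linarith
  have hd : HasDerivAt (fun y => Real.log (y / β)) (1 / t) t := by
    have h := ((hasDerivAt_id t).div_const β).log (by simp; exact ⟨ht0.ne', hβ.ne'⟩)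
    refine h.congr_deriv ?_
    simp only [id]
    field_simp
  by_cases hA : A = 0
  · have h := (hd.log h0.ne').const_mul α
    have hm : harmonicMain α β A = fun y => α * Real.log (Real.log (y / β)) := by
      funext y; simp [harmonicMain, hA]
    rw [hm]
    refine h.congr_deriv ?_
    rw [hA, zero_sub, Real.rpow_neg_one]
    field_simp
  · have h := (hd.rpow_const (p := A) (Or.inl h0.ne')).const_mul (α / A)
    have hm : harmonicMain α β A = fun y => α / A * Real.log (y / β) ^ A := by
      funext y; simp [harmonicMain, hA]
    rw [hm]
    refine h.congr_deriv ?_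
    field_simp

/-! ### Sums over the weight sequence -/

/-- `∫_b^x (log t)^{-r} dt ≪ x (log x)^{-r}`. -/
lemma exists_integral_log_rpow_le {b : ℝ} (hb : 4 ≤ b) {r : ℝ} (hr : 0 ≤ r) :
    ∃ C : ℝ, 0 < C ∧ ∀ x : ℝ, b ≤ x →
      ∫ t in b..x, Real.log t ^ (-r) ≤ C * (x * Real.log x ^ (-r)) := by
  obtain ⟨C, hC, h⟩ := exists_log_rpow_le hr
  refine ⟨2 * C, by positivity, fun x hx => ?_⟩
  have hx0 : 0 < x := by linarith
  have hlx := one_le_log (hb.trans hx)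
  have hd : ∀ t ∈ Set.uIcc b x, HasDerivAt (fun t => 2 * Real.sqrt t) (1 / Real.sqrt t) t := by
    intro t ht
    rw [Set.uIcc_of_le hx] at ht
    have ht0 : t ≠ 0 := by linarith [ht.1]
    refine ((Real.hasDerivAt_sqrt ht0).const_mul 2).congr_deriv ?_
    ring
  have hsq : ContinuousOn (fun t : ℝ => 1 / Real.sqrt t) (Set.Icc b x) := by
    apply ContinuousOn.div continuousOn_const (by fun_prop)
    intro t ht
    have : 0 < t := by linarith [ht.1]
    positivity
  have hint := intervalIntegral.integral_eq_sub_of_hasDerivAt hd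
    (ContinuousOn.intervalIntegrable (by rwa [Set.uIcc_of_le hx]))
  have hle : ∫ t in b..x, Real.log t ^ (-r) ≤
      ∫ t in b..x, C * Real.log x ^ (-r) * Real.sqrt x * (1 / Real.sqrt t) := by
    apply intervalIntegral.integral_mono_on hx
    · apply ContinuousOn.intervalIntegrable
      rw [Set.uIcc_of_le hx]
      exact (continuousOn_log_rpow (-r)).mono fun t ht => hb.trans ht.1
    · apply IntervalIntegrable.const_mul
      exact ContinuousOn.intervalIntegrable (by rwa [Set.uIcc_of_le hx])
    · intro t ht
      have ht0 : 0 < t := by linarith [ht.1]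
      have hlt := one_le_log (hb.trans ht.1)
      have h1 := h t x (hb.trans ht.1) ht.2
      rw [Real.sqrt_div hx0.le] at h1
      rw [Real.rpow_neg (by linarith), Real.rpow_neg (by linarith)]
      have hA : 0 < Real.log t ^ r := by positivity
      have hB : 0 < Real.log x ^ r := by positivity
      rw [inv_le_iff_one_le_mul₀ hA]
      calc (1 : ℝ) = (Real.log x ^ r)⁻¹ * Real.log x ^ r := by field_simp
        _ ≤ (Real.log x ^ r)⁻¹ * (C * Real.log t ^ r * (Real.sqrt x / Real.sqrt t)) := by gcongr
        _ = _ := by ring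
  rw [intervalIntegral.integral_const_mul, hint] at hle
  have hs := Real.mul_self_sqrt hx0.le
  have hpos : 0 ≤ C * Real.log x ^ (-r) * Real.sqrt x := by positivity
  calc _ ≤ _ := hle
    _ ≤ C * Real.log x ^ (-r) * Real.sqrt x * (2 * Real.sqrt x) := by
        apply mul_le_mul_of_nonneg_left _ hpos
        linarith [Real.sqrt_nonneg b]
    _ = 2 * C * (Real.sqrt x * Real.sqrt x * Real.log x ^ (-r)) := by ring
    _ = _ := by rw [hs]

namespace IsWeightSequence

variable {q : ℕ+ → ℝ} {α β A B : ℝ}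

/-- The finite set of indices `n` with `q_n ≤ x`. -/
noncomputable def upTo (hq : IsWeightSequence q α β A B) (x : ℝ) : Finset ℕ+ :=
  (hq.finite x).toFinset

/-- The finite set of indices `n` with `a < q_n ≤ b`. -/
noncomputable def block (hq : IsWeightSequence q α β A B) (a b : ℝ) : Finset ℕ+ :=
  (hq.upTo b).filter fun n => a < q n

lemma mem_upTo (hq : IsWeightSequence q α β A B) {x : ℝ} {n : ℕ+} :
    n ∈ hq.upTo x ↔ q n ≤ x := by
  simp [upTo]

lemma mem_block (hq : IsWeightSequence q α β A B) {a b : ℝ} {n : ℕ+} :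
    n ∈ hq.block a b ↔ a < q n ∧ q n ≤ b := by
  simp [block, mem_upTo, and_comm]

lemma sum_upTo_eq (hq : IsWeightSequence q α β A B) {a b : ℝ} (hab : a ≤ b) (F : ℕ+ → ℝ) :
    ∑ n ∈ hq.upTo b, F n = ∑ n ∈ hq.upTo a, F n + ∑ n ∈ hq.block a b, F n := by
  rw [block, ← Finset.sum_filter_not_add_sum_filter (hq.upTo b) (fun n => a < q n)]
  congr 1
  apply Finset.sum_congr _ fun _ _ => rfl
  ext n
  simp only [Finset.mem_filter, mem_upTo, not_lt]
  exact ⟨fun h => h.2, fun h => ⟨h.trans hab, h⟩⟩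

lemma count_eq_card (hq : IsWeightSequence q α β A B) (x : ℝ) :
    count q x = (hq.upTo x).card := by
  rw [count, Set.ncard_eq_toFinset_card _ (hq.finite x)]; rfl

lemma count_eq_sum (hq : IsWeightSequence q α β A B) (x : ℝ) :
    (count q x : ℝ) = ∑ _n ∈ hq.upTo x, (1 : ℝ) := by
  rw [hq.count_eq_card]; simp

lemma monotone_count (hq : IsWeightSequence q α β A B) :
    Monotone fun x => (count q x : ℝ) := by
  intro x y hxy
  simp only
  rw [hq.count_eq_card, hq.count_eq_card]
  norm_cast
  apply Finset.card_le_card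
  intro n
  simp only [mem_upTo]
  exact fun h => h.trans hxy

lemma finsum_eq_sum (hq : IsWeightSequence q α β A B) (x : ℝ) (F : ℕ+ → ℝ) :
    ∑ᶠ (n : ℕ+) (_ : q n ≤ x), F n = ∑ n ∈ hq.upTo x, F n :=
  finsum_mem_eq_finite_toFinset_sum F (hq.finite x)

/-- The counting error `𝒜(x) - α ∫_{β'}^x log(t/β)^{A-1} dt`. -/
noncomputable def countError (_hq : IsWeightSequence q α β A B) (x : ℝ) : ℝ :=
  (count q x : ℝ) - α * ∫ t in ((2 + β) ^ 2)..x, Real.log (t / β) ^ (A - 1)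

lemma exists_countError_le (hq : IsWeightSequence q α β A B) :
    ∃ K : ℝ, 0 < K ∧ ∀ x : ℝ, 2 * (2 + β) ^ 2 ≤ x →
      |hq.countError x| ≤ K * (x * Real.log x ^ (A - 1 - B)) := by
  have hβ := hq.beta_pos
  have hα := hq.alpha_pos
  have hA := hq.A_nonneg
  have hAB : A < B := (le_max_left _ _).trans_lt hq.lt_B
  obtain ⟨C, hC⟩ := hq.asymp
  have hb : (4 : ℝ) ≤ (2 + β) ^ 2 := by nlinarith
  obtain ⟨C₁, hC₁, h₁⟩ := exists_integral_log_rpow_le hb (r := B + 1 - A) (by linarith)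
  obtain ⟨K, hK, h⟩ := exists_log_div_rpow_comparable hβ (A - 1)
  refine ⟨(|C| + 1) * (α * (K * C₁)), by positivity, fun x hx => ?_⟩
  have hx' : (2 + β) ^ 2 ≤ x := by nlinarith
  have hcont1 : ContinuousOn (fun t => Real.log (t / β) ^ (A - 1) / Real.log t ^ B)
      (Set.Icc ((2 + β) ^ 2) x) := by
    apply ContinuousOn.div
    · exact (continuousOn_log_div_rpow hβ _).mono fun t ht => ht.1
    · exact (continuousOn_log_rpow _).mono fun t ht => hb.trans ht.1
    · intro t ht
      have := one_le_log (hb.trans ht.1)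
      positivity
  have hI : ∫ t in ((2 + β) ^ 2)..x, Real.log (t / β) ^ (A - 1) / Real.log t ^ B ≤
      K * (C₁ * (x * Real.log x ^ (A - 1 - B))) := by
    have e : A - 1 - B = -(B + 1 - A) := by ring
    rw [e]
    calc _ ≤ ∫ t in ((2 + β) ^ 2)..x, K * Real.log t ^ (-(B + 1 - A)) := by
          apply intervalIntegral.integral_mono_on hx'
          · exact ContinuousOn.intervalIntegrable (by rwa [Set.uIcc_of_le hx'])
          · apply IntervalIntegrable.const_mul
            apply ContinuousOn.intervalIntegrable
            rw [Set.uIcc_of_le hx']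
            exact (continuousOn_log_rpow _).mono fun t ht => hb.trans ht.1
          · intro t ht
            have hl := one_le_log (hb.trans ht.1)
            have := (h t ht.1).1
            have hl0 : 0 < Real.log t := by linarith
            rw [← e, Real.rpow_sub hl0 (A - 1) B, ← mul_div_assoc]
            gcongr
      _ ≤ _ := by
          rw [intervalIntegral.integral_const_mul]
          gcongr
          exact h₁ x hx'
  have hI0 : 0 ≤ ∫ t in ((2 + β) ^ 2)..x, Real.log (t / β) ^ (A - 1) / Real.log t ^ B := by
    apply intervalIntegral.integral_nonneg hx'
    intro t ht
    have := one_le_log (hb.trans ht.1)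
    have := log_div_pos hβ ht.1
    positivity
  calc |hq.countError x| ≤ _ := hC x hx
    _ ≤ (|C| + 1) * (α * (K * (C₁ * (x * Real.log x ^ (A - 1 - B))))) := by
        gcongr
        linarith [le_abs_self C]
    _ = _ := by ring

lemma hasDerivAt_integral_density (hq : IsWeightSequence q α β A B) {t : ℝ}
    (ht : 2 * (2 + β) ^ 2 ≤ t) :
    HasDerivAt (fun x => α * ∫ u in ((2 + β) ^ 2)..x, Real.log (u / β) ^ (A - 1))
      (α * Real.log (t / β) ^ (A - 1)) t := by
  have hβ := hq.beta_pos
  have hb : (0 : ℝ) < (2 + β) ^ 2 := by positivity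
  have hc := continuousOn_log_div_rpow hβ (A - 1)
  have hc' : ContinuousOn (fun t : ℝ => Real.log (t / β) ^ (A - 1)) (Set.Ioi ((2 + β) ^ 2)) :=
    hc.mono Set.Ioi_subset_Ici_self
  have hmem : t ∈ Set.Ioi ((2 + β) ^ 2) := by
    simp only [Set.mem_Ioi]; linarith
  apply HasDerivAt.const_mul
  apply intervalIntegral.integral_hasDerivAt_right
  · apply ContinuousOn.intervalIntegrable
    rw [Set.uIcc_of_le (le_of_lt hmem)]
    exact hc.mono fun t ht => ht.1
  · exact hc'.stronglyMeasurableAtFilter isOpen_Ioi t hmem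
  · exact hc'.continuousAt (isOpen_Ioi.mem_nhds hmem)

lemma integral_indicator_Ici {a b c : ℝ} (hac : a < c) (hcb : c ≤ b) (F : ℝ → ℝ) :
    ∫ t in a..b, F t * (if c ≤ t then 1 else 0) = ∫ t in c..b, F t := by
  rw [intervalIntegral.integral_of_le (hac.le.trans hcb), intervalIntegral.integral_of_le hcb]
  have : (fun t => F t * (if c ≤ t then 1 else 0)) = Set.indicator (Set.Ici c) F := by
    funext t
    by_cases h : c ≤ t <;> simp [h]
  rw [this, setIntegral_indicator measurableSet_Ici, ← integral_Icc_eq_integral_Ioc]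
  congr 2
  ext t
  simp only [Set.mem_inter_iff, Set.mem_Ioc, Set.mem_Ici, Set.mem_Icc]
  exact ⟨fun h => ⟨h.2, h.1.2⟩, fun h => ⟨⟨by linarith, h.2⟩, h.1⟩⟩

/-- Partial summation against the counting error. -/
lemma sum_block_sub_integral (hq : IsWeightSequence q α β A B) {a b : ℝ}
    (ha : 2 * (2 + β) ^ 2 ≤ a) (hab : a ≤ b) {φ φ' : ℝ → ℝ}
    (hφ : ∀ t ∈ Set.Icc a b, HasDerivAt φ (φ' t) t) (hφ' : ContinuousOn φ' (Set.Icc a b)) :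
    ∑ n ∈ hq.block a b, φ (q n) - ∫ t in a..b, φ t * (α * Real.log (t / β) ^ (A - 1)) =
      φ b * hq.countError b - φ a * hq.countError a - ∫ t in a..b, φ' t * hq.countError t := by
  have hβ := hq.beta_pos
  have hb0 : (0 : ℝ) < (2 + β) ^ 2 := by positivity
  have hφ'i : IntervalIntegrable φ' volume a b :=
    ContinuousOn.intervalIntegrable (by rwa [Set.uIcc_of_le hab])
  have hNi : IntervalIntegrable (fun t => (count q t : ℝ)) volume a b :=
    hq.monotone_count.intervalIntegrable
  have hφN : IntervalIntegrable (fun t => φ' t * (count q t : ℝ)) volume a b :=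
    hNi.continuousOn_mul (by rwa [Set.uIcc_of_le hab])
  have hρi : IntervalIntegrable (fun t => α * Real.log (t / β) ^ (A - 1)) volume a b := by
    apply IntervalIntegrable.const_mul
    apply ContinuousOn.intervalIntegrable
    rw [Set.uIcc_of_le hab]
    exact (continuousOn_log_div_rpow hβ _).mono fun t ht => by
      simp only [Set.mem_Ici]; linarith [ht.1]
  set M : ℝ → ℝ := fun x => α * ∫ u in ((2 + β) ^ 2)..x, Real.log (u / β) ^ (A - 1) with hM
  have hMd : ∀ t ∈ Set.uIcc a b, HasDerivAt M (α * Real.log (t / β) ^ (A - 1)) t := by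
    intro t ht
    rw [Set.uIcc_of_le hab] at ht
    exact hq.hasDerivAt_integral_density (ha.trans ht.1)
  have hMc : ContinuousOn M (Set.uIcc a b) := fun t ht =>
    (hMd t ht).continuousAt.continuousWithinAt
  have hφM : IntervalIntegrable (fun t => φ' t * M t) volume a b :=
    (hMc.intervalIntegrable).continuousOn_mul (by rwa [Set.uIcc_of_le hab])
  have hparts := intervalIntegral.integral_mul_deriv_eq_deriv_mul
    (fun t ht => hφ t (by rwa [Set.uIcc_of_le hab] at ht)) hMd hφ'i hρi
  -- Each term is written as an integral over `t ≥ q_n`; summing over `n` produces `𝒜(t) - 𝒜(a)`.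
  have hterm : ∀ n ∈ hq.block a b,
      φ (q n) = φ b - ∫ t in a..b, φ' t * (if q n ≤ t then 1 else 0) := by
    intro n hn
    rw [hq.mem_block] at hn
    rw [integral_indicator_Ici hn.1 hn.2, intervalIntegral.integral_eq_sub_of_hasDerivAt
      (f := φ) (f' := φ')]
    · ring
    · intro t ht
      rw [Set.uIcc_of_le hn.2] at ht
      exact hφ t ⟨hn.1.le.trans ht.1, ht.2⟩
    · apply hφ'i.mono_set
      rw [Set.uIcc_of_le hab, Set.uIcc_of_le hn.2]
      exact Set.Icc_subset_Icc_left hn.1.le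
  have hti : ∀ n ∈ hq.block a b,
      IntervalIntegrable (fun t => φ' t * (if q n ≤ t then 1 else 0)) volume a b := by
    intro n _
    apply IntervalIntegrable.continuousOn_mul _ (by rwa [Set.uIcc_of_le hab])
    apply Monotone.intervalIntegrable
    intro x y hxy
    simp only
    split_ifs <;> linarith
  have hcard : ((hq.block a b).card : ℝ) = count q b - count q a := by
    have := hq.sum_upTo_eq hab fun _ => 1
    rw [← hq.count_eq_sum, ← hq.count_eq_sum] at this
    simp at this
    linarith
  have hsum : ∑ n ∈ hq.block a b, φ (q n) =
      φ b * (count q b - count q a) - ∫ t in a..b, φ' t * ((count q t : ℝ) - count q a) := by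
    rw [Finset.sum_congr rfl hterm, Finset.sum_sub_distrib, Finset.sum_const, nsmul_eq_mul,
      hcard, ← intervalIntegral.integral_finsetSum hti, mul_comm]
    congr 1
    apply intervalIntegral.integral_congr
    intro t ht
    rw [Set.uIcc_of_le hab] at ht
    simp only
    rw [← Finset.mul_sum]
    congr 1
    have h1 := hq.sum_upTo_eq ht.1 fun _ => 1
    rw [← hq.count_eq_sum, ← hq.count_eq_sum] at h1
    rw [h1, add_sub_cancel_left, ← Finset.sum_filter]
    apply Finset.sum_congr _ fun _ _ => rfl
    ext n
    simp only [Finset.mem_filter, mem_block]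
    exact ⟨fun h => ⟨h.1.1, h.2⟩, fun h => ⟨⟨h.1, h.2.trans ht.2⟩, h.2⟩⟩
  have hφd : ∫ t in a..b, φ' t = φ b - φ a :=
    intervalIntegral.integral_eq_sub_of_hasDerivAt
      (fun t ht => hφ t (by rwa [Set.uIcc_of_le hab] at ht)) hφ'i
  have hI1 : ∫ t in a..b, φ' t * ((count q t : ℝ) - count q a) =
      (∫ t in a..b, φ' t * (count q t : ℝ)) - (φ b - φ a) * count q a := by
    simp only [mul_sub]
    rw [intervalIntegral.integral_sub hφN (hφ'i.mul_const _),
      intervalIntegral.integral_mul_const, hφd]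
  have hI2 : ∫ t in a..b, φ' t * hq.countError t =
      (∫ t in a..b, φ' t * (count q t : ℝ)) - ∫ t in a..b, φ' t * M t := by
    rw [← intervalIntegral.integral_sub hφN hφM]
    apply intervalIntegral.integral_congr
    intro t _
    simp only [countError, hM]
    ring
  rw [hsum, hI1, hI2, hparts]
  simp only [countError, hM]
  ring

/-- Comparison of a sum over the weight sequence with the corresponding integral: the relative
precision is that of the counting function, and one power of the logarithm is lost. -/
lemma exists_sum_block_sub_integral_le (hq : IsWeightSequence q α β A B) :
    ∃ K : ℝ, 0 < K ∧ ∀ (a b k : ℝ) (φ φ' : ℝ → ℝ), 2 * (2 + β) ^ 2 ≤ a → a ≤ b →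
      (∀ t ∈ Set.Icc a b, HasDerivAt φ (φ' t) t) → ContinuousOn φ' (Set.Icc a b) →
      (∀ t ∈ Set.Icc a b, |φ t| ≤ k / t) → (∀ t ∈ Set.Icc a b, |φ' t| ≤ k / t ^ 2) →
      |∑ n ∈ hq.block a b, φ (q n) - ∫ t in a..b, φ t * (α * Real.log (t / β) ^ (A - 1))| ≤
        k * (K * Real.log a ^ (A - B)) := by
  have hβ := hq.beta_pos
  have hA := hq.A_nonneg
  have hAB : A < B := (le_max_left _ _).trans_lt hq.lt_B
  obtain ⟨K, hK, h⟩ := hq.exists_countError_le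
  have hBA : 0 < B - A := by linarith
  refine ⟨K * (2 + 1 / (B - A)), by positivity, fun a b k φ φ' ha hab hφ hφ' hb1 hb2 => ?_⟩
  rw [hq.sum_block_sub_integral ha hab hφ hφ']
  have h4 : (4 : ℝ) ≤ (2 + β) ^ 2 := by nlinarith
  have ha4 : 4 ≤ a := by linarith
  have hla := one_le_log ha4
  have hk : 0 ≤ k := by
    have := (abs_nonneg _).trans (hb1 a ⟨le_rfl, hab⟩)
    rw [le_div_iff₀ (by linarith)] at this
    linarith
  have hpt : ∀ t ∈ Set.Icc a b, |φ t * hq.countError t| ≤ k * (K * Real.log a ^ (A - B)) := by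
    intro t ht
    have ht0 : 0 < t := by linarith [ht.1]
    have hlat : Real.log a ≤ Real.log t := Real.log_le_log (by linarith) ht.1
    rw [abs_mul]
    calc _ ≤ k / t * (K * (t * Real.log t ^ (A - 1 - B))) := by
          gcongr
          · exact hb1 t ht
          · exact h t (ha.trans ht.1)
      _ = k * (K * Real.log t ^ (A - 1 - B)) := by field_simp
      _ ≤ k * (K * Real.log t ^ (A - B)) := by
          gcongr
          · linarith
          · linarith
      _ ≤ _ := by
          gcongr k * (K * ?_)
          exact Real.rpow_le_rpow_of_nonpos (by linarith) hlat (by linarith)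
  have hd : ∀ t ∈ Set.uIcc a b, HasDerivAt (fun t => Real.log t ^ (A - B) / (A - B))
      (Real.log t ^ (A - 1 - B) / t) t := by
    intro t ht
    rw [Set.uIcc_of_le hab] at ht
    have ht4 : 4 ≤ t := ha4.trans ht.1
    have hlt := one_le_log ht4
    have h1 := ((Real.hasDerivAt_log (x := t) (by linarith)).rpow_const (p := A - B)
      (Or.inl (by linarith))).div_const (A - B)
    refine h1.congr_deriv ?_
    have hne : A - B ≠ 0 := by linarith
    rw [show A - 1 - B = A - B - 1 by ring]
    field_simp
  have hci : IntervalIntegrable (fun t => Real.log t ^ (A - 1 - B) / t) volume a b := by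
    apply ContinuousOn.intervalIntegrable
    rw [Set.uIcc_of_le hab]
    apply ContinuousOn.div
    · exact (continuousOn_log_rpow _).mono fun t ht => ha4.trans ht.1
    · fun_prop
    · intro t ht; linarith [ht.1]
  have hint := intervalIntegral.integral_eq_sub_of_hasDerivAt hd hci
  have hI : |∫ t in a..b, φ' t * hq.countError t| ≤
      k * K * (Real.log a ^ (A - B) / (B - A)) := by
    have := intervalIntegral.norm_integral_le_of_norm_le (μ := volume)
      (f := fun t => φ' t * hq.countError t)
      (g := fun t => k * K * (Real.log t ^ (A - 1 - B) / t)) hab ?_ (hci.const_mul _)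
    · rw [Real.norm_eq_abs, intervalIntegral.integral_const_mul, hint] at this
      refine this.trans ?_
      have hlb : 0 ≤ Real.log b ^ (A - B) := by
        have := one_le_log (ha4.trans hab)
        positivity
      have e : Real.log b ^ (A - B) / (A - B) - Real.log a ^ (A - B) / (A - B) =
          Real.log a ^ (A - B) / (B - A) - Real.log b ^ (A - B) / (B - A) := by
        rw [← neg_sub B A, div_neg, div_neg]; ring
      rw [e]
      gcongr
      have : 0 ≤ Real.log b ^ (A - B) / (B - A) := by positivity
      linarith
    · refine Filter.Eventually.of_forall fun t ht => ?_
      have ht' : t ∈ Set.Icc a b := ⟨ht.1.le, ht.2⟩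
      have ht0 : 0 < t := by linarith [ht.1]
      rw [Real.norm_eq_abs, abs_mul]
      calc _ ≤ k / t ^ 2 * (K * (t * Real.log t ^ (A - 1 - B))) := by
            gcongr
            · exact hb2 t ht'
            · exact h t (ha.trans ht'.1)
        _ = _ := by field_simp
  have h1 := hpt a ⟨le_rfl, hab⟩
  have h2 := hpt b ⟨hab, le_rfl⟩
  rw [abs_le] at *
  have e : k * (K * (2 + 1 / (B - A)) * Real.log a ^ (A - B)) =
      k * (K * Real.log a ^ (A - B)) + k * (K * Real.log a ^ (A - B)) +
      k * K * (Real.log a ^ (A - B) / (B - A)) := by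
    field_simp; ring
  rw [e]
  constructor <;> linarith [h1.1, h1.2, h2.1, h2.2, hI.1, hI.2]

end IsWeightSequence

namespace IsWeightSequence

variable {q : ℕ+ → ℝ} {α β A B : ℝ}

lemma lt_B' (hq : IsWeightSequence q α β A B) : A < B := (le_max_left _ _).trans_lt hq.lt_B

lemma one_lt_B (hq : IsWeightSequence q α β A B) : 1 < B := (le_max_right _ _).trans_lt hq.lt_B

lemma four_le_sq (hq : IsWeightSequence q α β A B) : (4 : ℝ) ≤ (2 + β) ^ 2 := by
  nlinarith [hq.beta_pos]

lemma q_pos (hq : IsWeightSequence q α β A B) (n : ℕ+) : 0 < q n := by linarith [hq.one_le n]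

lemma continuousOn_density (hq : IsWeightSequence q α β A B) {a b : ℝ} (ha : (2 + β) ^ 2 ≤ a) :
    ContinuousOn (fun t => α * Real.log (t / β) ^ (A - 1)) (Set.Icc a b) :=
  continuousOn_const.mul ((continuousOn_log_div_rpow hq.beta_pos _).mono fun _ ht => ha.trans ht.1)

lemma density_pos (hq : IsWeightSequence q α β A B) {t : ℝ} (ht : (2 + β) ^ 2 ≤ t) :
    0 < α * Real.log (t / β) ^ (A - 1) := by
  have := log_div_pos hq.beta_pos ht
  have := hq.alpha_pos
  positivity

lemma integral_density_div (hq : IsWeightSequence q α β A B) {a b : ℝ} (ha : (2 + β) ^ 2 ≤ a)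
    (hab : a ≤ b) :
    ∫ t in a..b, 1 / t * (α * Real.log (t / β) ^ (A - 1)) =
      harmonicMain α β A b - harmonicMain α β A a := by
  have h4 := hq.four_le_sq
  apply intervalIntegral.integral_eq_sub_of_hasDerivAt
  · intro t ht
    rw [Set.uIcc_of_le hab] at ht
    refine (hasDerivAt_harmonicMain hq.beta_pos (ha.trans ht.1)).congr_deriv ?_
    ring
  · apply ContinuousOn.intervalIntegrable
    rw [Set.uIcc_of_le hab]
    apply ContinuousOn.mul _ (hq.continuousOn_density ha)
    apply ContinuousOn.div continuousOn_const (by fun_prop)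
    intro t ht
    linarith [ht.1]

lemma harmonicSum_eq (hq : IsWeightSequence q α β A B) (x : ℝ) :
    harmonicSum q x = ∑ n ∈ hq.upTo x, 1 / q n := hq.finsum_eq_sum x _

lemma exists_sum_block_inv_sub_le (hq : IsWeightSequence q α β A B) :
    ∃ K : ℝ, 0 < K ∧ ∀ a b : ℝ, 2 * (2 + β) ^ 2 ≤ a → a ≤ b →
      |∑ n ∈ hq.block a b, 1 / q n - (harmonicMain α β A b - harmonicMain α β A a)| ≤
        K * Real.log a ^ (A - B) := by
  obtain ⟨K, hK, h⟩ := hq.exists_sum_block_sub_integral_le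
  have h4 := hq.four_le_sq
  refine ⟨K, hK, fun a b ha hab => ?_⟩
  have := h a b 1 (fun t => 1 / t) (fun t => -(1 / t ^ 2)) ha hab ?_ ?_ ?_ ?_
  · rwa [hq.integral_density_div (by linarith) hab, one_mul] at this
  · intro t ht
    have ht0 : t ≠ 0 := by linarith [ht.1]
    simpa using hasDerivAt_inv ht0
  · apply ContinuousOn.neg
    apply ContinuousOn.div continuousOn_const (by fun_prop)
    intro t ht
    have : 0 < t := by linarith [ht.1]
    positivity
  · intro t ht
    have : 0 < t := by linarith [ht.1]
    rw [abs_of_pos (by positivity)]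
  · intro t ht
    rw [abs_neg, abs_of_nonneg (by positivity)]

/-- The constant `C_𝒜` exists, and the harmonic sum converges to its asymptotic at a rate that is
a power of the logarithm. -/
lemma exists_harmonicSum_limit (hq : IsWeightSequence q α β A B) :
    ∃ CA K : ℝ, 0 < K ∧
      Tendsto (fun y => harmonicSum q y - harmonicMain α β A y) atTop (𝓝 CA) ∧
      ∀ a : ℝ, 2 * (2 + β) ^ 2 ≤ a →
        |harmonicSum q a - harmonicMain α β A a - CA| ≤ K * Real.log a ^ (A - B) := by
  obtain ⟨K, hK, h⟩ := hq.exists_sum_block_inv_sub_le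
  have h4 := hq.four_le_sq
  have hAB := hq.lt_B'
  set D : ℝ → ℝ := fun y => harmonicSum q y - harmonicMain α β A y with hD
  have hdist : ∀ a b : ℝ, 2 * (2 + β) ^ 2 ≤ a → a ≤ b →
      |D b - D a| ≤ K * Real.log a ^ (A - B) := by
    intro a b ha hab
    have h1 := h a b ha hab
    have h2 := hq.sum_upTo_eq hab fun n => 1 / q n
    rw [← hq.harmonicSum_eq, ← hq.harmonicSum_eq] at h2
    rw [hD]
    convert h1 using 2
    linarith
  have hto : Tendsto (fun a : ℝ => K * Real.log a ^ (A - B)) atTop (𝓝 0) := by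
    have h1 := (tendsto_rpow_neg_atTop (y := B - A) (by linarith)).comp Real.tendsto_log_atTop
    have h2 := h1.const_mul K
    rw [mul_zero] at h2
    refine h2.congr fun a => ?_
    simp [neg_sub]
  have hC : CauchySeq D := by
    rw [Metric.cauchySeq_iff']
    intro ε hε
    obtain ⟨N, hN1, hN2⟩ := ((hto.eventually (gt_mem_nhds hε)).and
      (eventually_ge_atTop (2 * (2 + β) ^ 2))).exists
    exact ⟨N, fun n hn => lt_of_le_of_lt (hdist N n hN2 hn) hN1⟩
  obtain ⟨CA, hCA⟩ := cauchySeq_tendsto_of_complete hC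
  refine ⟨CA, K, hK, hCA, fun a ha => ?_⟩
  have h1 : Tendsto (fun b => |D b - D a|) atTop (𝓝 |CA - D a|) := (hCA.sub_const _).abs
  have h2 := le_of_tendsto h1 ((eventually_ge_atTop a).mono fun b hb => hdist a b ha hb)
  rwa [abs_sub_comm] at h2

/-- The harmonic sum is at most `(log a)^A`, up to a factor `log log a` that is needed when
`A = 0` only. -/
lemma exists_harmonicSum_le (hq : IsWeightSequence q α β A B) :
    ∃ K a₀ : ℝ, 0 < K ∧ ∀ a : ℝ, a₀ ≤ a →
      harmonicSum q a ≤ K * (Real.log a ^ A * Real.log (Real.log a)) := by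
  obtain ⟨CA, K, hK, -, h⟩ := hq.exists_harmonicSum_limit
  have hβ := hq.beta_pos
  have hα := hq.alpha_pos
  have hA := hq.A_nonneg
  have hAB := hq.lt_B'
  obtain ⟨K₁, hK₁, h₁⟩ := exists_log_div_rpow_comparable hβ A
  have hev : ∀ᶠ a in atTop, 1 ≤ Real.log (Real.log a) :=
    (Real.tendsto_log_atTop.comp Real.tendsto_log_atTop).eventually_ge_atTop 1
  obtain ⟨a₁, ha₁⟩ := eventually_atTop.1 hev
  set κ : ℝ := Real.log (2 + |Real.log β|) with hκ
  have hκ0 : 0 ≤ κ := Real.log_nonneg (by linarith [abs_nonneg (Real.log β)])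
  refine ⟨(if A = 0 then α * (1 + κ) else α / A * K₁) + |CA| + K,
    max a₁ (2 * (2 + β) ^ 2), by split_ifs <;> positivity, fun a ha => ?_⟩
  have ha1 := ha₁ a ((le_max_left _ _).trans ha)
  have ha2 : 2 * (2 + β) ^ 2 ≤ a := (le_max_right _ _).trans ha
  have ha3 : (2 + β) ^ 2 ≤ a := by nlinarith
  obtain ⟨-, hl1, -, hl3⟩ := log_div_bounds hβ ha3
  have hp := log_div_pos hβ ha3
  have hLA : 1 ≤ Real.log a ^ A := Real.one_le_rpow hl1 hA
  have hX : 1 ≤ Real.log a ^ A * Real.log (Real.log a) := by nlinarith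
  have h2 : Real.log a ^ (A - B) ≤ 1 := Real.rpow_le_one_of_one_le_of_nonpos hl1 (by linarith)
  have h3 := (abs_le.1 (h a ha2)).2
  have hm : harmonicMain α β A a ≤ (if A = 0 then α * (1 + κ) else α / A * K₁) *
      (Real.log a ^ A * Real.log (Real.log a)) := by
    unfold harmonicMain
    split_ifs with h0
    · subst h0
      rw [Real.rpow_zero, one_mul, mul_assoc]
      gcongr
      calc Real.log (Real.log (a / β)) ≤ Real.log ((2 + |Real.log β|) * Real.log a) :=
            Real.log_le_log hp hl3
        _ = κ + Real.log (Real.log a) := by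
            rw [Real.log_mul (by positivity) (by linarith)]
        _ ≤ _ := by nlinarith
    · have hA' : 0 < A := lt_of_le_of_ne hA (Ne.symm h0)
      have := (h₁ a ha3).1
      rw [mul_assoc]
      gcongr
      calc _ ≤ _ := this
        _ ≤ K₁ * (Real.log a ^ A * Real.log (Real.log a)) := by
          gcongr
          nlinarith
  calc harmonicSum q a ≤ harmonicMain α β A a + |CA| + K := by
        have := le_abs_self CA
        nlinarith
    _ ≤ _ := by
        rw [add_mul, add_mul]
        have := abs_nonneg CA
        gcongr
        · nlinarith
        · nlinarith

lemma exists_density_le (hq : IsWeightSequence q α β A B) :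
    ∃ K : ℝ, 0 < K ∧ ∀ t : ℝ, (2 + β) ^ 2 ≤ t →
      α * Real.log (t / β) ^ (A - 1) ≤ K * Real.log t ^ (A - 1) := by
  obtain ⟨K₁, hK₁, h₁⟩ := exists_log_div_rpow_comparable hq.beta_pos (A - 1)
  have hα := hq.alpha_pos
  refine ⟨α * K₁, by positivity, fun t ht => ?_⟩
  rw [mul_assoc]
  gcongr
  exact (h₁ t ht).1

lemma exists_sum_block_inv_le (hq : IsWeightSequence q α β A B) :
    ∃ K : ℝ, 0 < K ∧ ∀ a b : ℝ, 2 * (2 + β) ^ 2 ≤ a → a ≤ b → b ≤ a ^ 4 →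
      ∑ n ∈ hq.block a b, 1 / q n ≤ K * Real.log a ^ A := by
  obtain ⟨K, hK, h⟩ := hq.exists_sum_block_inv_sub_le
  obtain ⟨K₁, hK₁, h₁⟩ := hq.exists_density_le
  have hA := hq.A_nonneg
  have hB := hq.one_lt_B
  have hAB := hq.lt_B'
  have h4 := hq.four_le_sq
  refine ⟨K₁ * 4 ^ |A - 1| * 3 + K, by positivity, fun a b ha hab hb => ?_⟩
  have ha' : (2 + β) ^ 2 ≤ a := by nlinarith
  have ha0 : 0 < a := by linarith
  have hb0 : 0 < b := by linarith
  have hla := one_le_log (h4.trans ha')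
  have hlb : Real.log b ≤ 4 * Real.log a := by
    have := Real.log_le_log hb0 hb
    rw [Real.log_pow] at this
    exact_mod_cast this
  have h2 := (abs_le.1 (h a b ha hab)).2
  have hI : harmonicMain α β A b - harmonicMain α β A a ≤
      K₁ * 4 ^ |A - 1| * 3 * Real.log a ^ A := by
    rw [← hq.integral_density_div ha' hab]
    have hd : ∀ t ∈ Set.uIcc a b, HasDerivAt Real.log (1 / t) t := by
      intro t ht
      rw [Set.uIcc_of_le hab] at ht
      simpa using Real.hasDerivAt_log (x := t) (by linarith [ht.1])
    have hc : ContinuousOn (fun t : ℝ => 1 / t) (Set.Icc a b) := by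
      apply ContinuousOn.div continuousOn_const (by fun_prop)
      intro t ht
      linarith [ht.1]
    have hci : IntervalIntegrable (fun t : ℝ => 1 / t) volume a b :=
      ContinuousOn.intervalIntegrable (by rwa [Set.uIcc_of_le hab])
    have hint := intervalIntegral.integral_eq_sub_of_hasDerivAt hd hci
    calc _ ≤ ∫ t in a..b, 1 / t * (K₁ * (4 ^ |A - 1| * Real.log a ^ (A - 1))) := by
          apply intervalIntegral.integral_mono_on hab
          · apply ContinuousOn.intervalIntegrable
            rw [Set.uIcc_of_le hab]
            exact hc.mul (hq.continuousOn_density ha')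
          · exact hci.mul_const _
          · intro t ht
            have ht0 : 0 < t := by linarith [ht.1]
            have hlt : Real.log a ≤ Real.log t := Real.log_le_log ha0 ht.1
            have hlt' : Real.log t ≤ 4 * Real.log a :=
              (Real.log_le_log ht0 ht.2).trans hlb
            refine mul_le_mul_of_nonneg_left ((h₁ t (ha'.trans ht.1)).trans ?_) (by positivity)
            gcongr
            exact rpow_le_mul_rpow _ (by linarith) (by linarith) (by norm_num) hlt' (by linarith)
      _ = (Real.log b - Real.log a) * (K₁ * (4 ^ |A - 1| * Real.log a ^ (A - 1))) := by
          rw [intervalIntegral.integral_mul_const, hint]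
      _ ≤ (3 * Real.log a) * (K₁ * (4 ^ |A - 1| * Real.log a ^ (A - 1))) := by
          gcongr
          linarith
      _ = _ := by
          have : Real.log a ^ A = Real.log a ^ (A - 1) * Real.log a := by
            rw [← Real.rpow_add_one (by linarith)]; ring_nf
          rw [this]; ring
  have h5 : Real.log a ^ (A - B) ≤ Real.log a ^ A :=
    Real.rpow_le_rpow_of_exponent_le hla (by linarith)
  have h6 : K * Real.log a ^ (A - B) ≤ K * Real.log a ^ A := by gcongr
  linarith

/-- The tail of `∑ 1/q_n²` is of the order of the density divided by the cut-off point. -/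
lemma exists_sum_block_inv_sq_le (hq : IsWeightSequence q α β A B) :
    ∃ K : ℝ, 0 < K ∧ ∀ a b : ℝ, 2 * (2 + β) ^ 2 ≤ a → a ≤ b →
      ∑ n ∈ hq.block a b, 1 / q n ^ 2 ≤ K * (Real.log a ^ (A - 1) / a) := by
  obtain ⟨K, hK, h⟩ := hq.exists_sum_block_sub_integral_le
  obtain ⟨K₁, hK₁, h₁⟩ := hq.exists_density_le
  obtain ⟨C, hC, h₂⟩ := exists_log_rpow_le (r := |A - 1|) (abs_nonneg _)
  have hB := hq.one_lt_B
  have h4 := hq.four_le_sq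
  refine ⟨K₁ * (C + 1) * 2 + 2 * K, by positivity, fun a b ha hab => ?_⟩
  have ha' : (2 + β) ^ 2 ≤ a := by nlinarith
  have ha0 : 0 < a := by linarith
  have hla := one_le_log (h4.trans ha')
  have hc : ContinuousOn (fun t : ℝ => 1 / t ^ 2) (Set.Icc a b) := by
    apply ContinuousOn.div continuousOn_const (by fun_prop)
    intro t ht
    have : 0 < t := by linarith [ht.1]
    positivity
  have h5 := h a b (2 / a) (fun t => 1 / t ^ 2) (fun t => -(2 / t ^ 3)) ha hab ?_ ?_ ?_ ?_
  · have h6 := (abs_le.1 h5).2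
    have hcs : ContinuousOn (fun t : ℝ => 1 / (t * Real.sqrt t)) (Set.Icc a b) := by
      apply ContinuousOn.div continuousOn_const (by fun_prop)
      intro t ht
      have : 0 < t := by linarith [ht.1]
      positivity
    have hcsi : IntervalIntegrable (fun t : ℝ => 1 / (t * Real.sqrt t)) volume a b :=
      ContinuousOn.intervalIntegrable (by rwa [Set.uIcc_of_le hab])
    have hint := intervalIntegral.integral_eq_sub_of_hasDerivAt
      (f := fun t => -(2 / Real.sqrt t)) (f' := fun t => 1 / (t * Real.sqrt t)) (a := a) (b := b)
      (by
        intro t ht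
        rw [Set.uIcc_of_le hab] at ht
        have ht0 : 0 < t := by linarith [ht.1]
        have hs : 0 < Real.sqrt t := Real.sqrt_pos.2 ht0
        have h7 := (((Real.hasDerivAt_sqrt ht0.ne').inv hs.ne').const_mul 2).neg
        refine h7.congr_deriv ?_
        rw [Real.sq_sqrt ht0.le]
        field_simp) hcsi
    have hI : ∫ t in a..b, 1 / t ^ 2 * (α * Real.log (t / β) ^ (A - 1)) ≤
        K₁ * (C + 1) * 2 * (Real.log a ^ (A - 1) / a) := by
      calc _ ≤ ∫ t in a..b, K₁ * ((C + 1) * Real.log a ^ (A - 1) / Real.sqrt a) *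
            (1 / (t * Real.sqrt t)) := by
            apply intervalIntegral.integral_mono_on hab
            · apply ContinuousOn.intervalIntegrable
              rw [Set.uIcc_of_le hab]
              exact hc.mul (hq.continuousOn_density ha')
            · exact hcsi.const_mul _
            · intro t ht
              have ht0 : 0 < t := by linarith [ht.1]
              have hlt : Real.log a ≤ Real.log t := Real.log_le_log ha0 ht.1
              have hr : 1 ≤ Real.sqrt (t / a) := by
                rw [Real.one_le_sqrt, one_le_div ha0]; exact ht.1
              have hsq : Real.log t ^ (A - 1) ≤
                  (C + 1) * Real.log a ^ (A - 1) * Real.sqrt (t / a) := by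
                have hpa : 0 < Real.log a ^ (A - 1) := by positivity
                rcases le_total 0 (A - 1) with hs | hs
                · have := h₂ a t (h4.trans ha') ht.1
                  rw [abs_of_nonneg hs] at this
                  refine this.trans ?_
                  gcongr
                  linarith
                · calc Real.log t ^ (A - 1) ≤ Real.log a ^ (A - 1) :=
                        Real.rpow_le_rpow_of_nonpos (by linarith) hlt hs
                    _ = 1 * Real.log a ^ (A - 1) * 1 := by ring
                    _ ≤ _ := by gcongr; linarith
              calc 1 / t ^ 2 * (α * Real.log (t / β) ^ (A - 1))
                  ≤ 1 / t ^ 2 * (K₁ * ((C + 1) * Real.log a ^ (A - 1) * Real.sqrt (t / a))) := by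
                    refine mul_le_mul_of_nonneg_left ((h₁ t (ha'.trans ht.1)).trans ?_)
                      (by positivity)
                    gcongr
                _ = _ := by
                    rw [Real.sqrt_div ht0.le]
                    have hs : 0 < Real.sqrt t := Real.sqrt_pos.2 ht0
                    have hs2 := Real.mul_self_sqrt ht0.le
                    have hsa : 0 < Real.sqrt a := Real.sqrt_pos.2 ha0
                    field_simp
                    rw [sq, hs2]
        _ ≤ _ := by
            rw [intervalIntegral.integral_const_mul, hint]
            have hsb : 0 ≤ 2 / Real.sqrt b := by positivity
            have hsa : 0 < Real.sqrt a := Real.sqrt_pos.2 ha0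
            calc _ ≤ K₁ * ((C + 1) * Real.log a ^ (A - 1) / Real.sqrt a) *
                  (2 / Real.sqrt a) := by
                  gcongr; linarith
              _ = _ := by
                  have hs2 := Real.mul_self_sqrt ha0.le
                  field_simp
                  rw [sq, hs2]
    have h7 : 2 / a * (K * Real.log a ^ (A - B)) ≤ 2 * K * (Real.log a ^ (A - 1) / a) := by
      have : Real.log a ^ (A - B) ≤ Real.log a ^ (A - 1) :=
        Real.rpow_le_rpow_of_exponent_le hla (by linarith)
      calc _ ≤ 2 / a * (K * Real.log a ^ (A - 1)) := by gcongr
        _ = _ := by ring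
    linarith
  · intro t ht
    have ht0 : t ≠ 0 := by linarith [ht.1]
    have h7 := (hasDerivAt_pow 2 t).inv (by positivity)
    simp only [one_div]
    refine h7.congr_deriv ?_
    field_simp
    ring
  · apply ContinuousOn.neg
    apply ContinuousOn.div continuousOn_const (by fun_prop)
    intro t ht
    have : 0 < t := by linarith [ht.1]
    positivity
  · intro t ht
    have ht0 : 0 < t := by linarith [ht.1]
    rw [abs_of_pos (by positivity), div_div, div_le_div_iff₀ (by positivity) (by positivity)]
    nlinarith [ht.1]
  · intro t ht
    have ht0 : 0 < t := by linarith [ht.1]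
    rw [abs_neg, abs_of_pos (by positivity), div_div,
      div_le_div_iff₀ (by positivity) (by positivity)]
    have : a * t ^ 2 ≤ t * t ^ 2 := by gcongr; exact ht.1
    nlinarith

/-- The sequence has at least `√a` terms up to `a`, so that `log n ≫ log q_n`. -/
lemma exists_sqrt_le_count (hq : IsWeightSequence q α β A B) :
    ∃ a₀ : ℝ, ∀ a : ℝ, a₀ ≤ a → Real.sqrt a ≤ count q a := by
  obtain ⟨K, hK, h⟩ := hq.exists_countError_le
  have hβ := hq.beta_pos
  have hα := hq.alpha_pos
  have hA := hq.A_nonneg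
  have hB := hq.one_lt_B
  have h4 := hq.four_le_sq
  obtain ⟨K₁, hK₁, h₁⟩ := exists_log_div_rpow_comparable hβ (A - 1)
  set c : ℝ := α / (K₁ * 2 ^ |A - 1|) with hc
  have hc0 : 0 < c := by positivity
  have hev1 : ∀ᶠ a : ℝ in atTop, 4 * K / c ≤ Real.log a ^ B :=
    ((tendsto_rpow_atTop (by linarith : 0 < B)).comp
      Real.tendsto_log_atTop).eventually_ge_atTop _
  have hev2 : ∀ᶠ a : ℝ in atTop, ‖Real.log a‖ ≤ c / 4 * ‖a ^ (1 / 2 : ℝ)‖ :=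
    (isLittleO_log_rpow_atTop (by norm_num)).bound (by positivity)
  obtain ⟨a₁, ha₁⟩ := eventually_atTop.1 (hev1.and hev2)
  refine ⟨max a₁ (2 * (2 + β) ^ 2), fun a ha => ?_⟩
  obtain ⟨h2, h3⟩ := ha₁ a ((le_max_left _ _).trans ha)
  have ha' : 2 * (2 + β) ^ 2 ≤ a := (le_max_right _ _).trans ha
  have ha'' : (2 + β) ^ 2 ≤ a / 2 := by linarith
  have ha0 : 0 < a := by linarith
  have hla := one_le_log (by linarith : 4 ≤ a)
  rw [Real.norm_of_nonneg (by linarith), ← Real.sqrt_eq_rpow,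
    Real.norm_of_nonneg (Real.sqrt_nonneg _)] at h3
  have hρi : ∀ x y : ℝ, (2 + β) ^ 2 ≤ x → x ≤ y →
      IntervalIntegrable (fun t => Real.log (t / β) ^ (A - 1)) volume x y := by
    intro x y hx hxy
    apply ContinuousOn.intervalIntegrable
    rw [Set.uIcc_of_le hxy]
    exact (continuousOn_log_div_rpow hβ _).mono fun t ht => hx.trans ht.1
  -- The part `[a/2, a]` of the integral alone has the right order of magnitude.
  have hM : c * (a / 2) * Real.log a ^ (A - 1) ≤
      α * ∫ t in ((2 + β) ^ 2)..a, Real.log (t / β) ^ (A - 1) := by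
    rw [← intervalIntegral.integral_add_adjacent_intervals (hρi _ (a / 2) le_rfl ha'')
      (hρi _ a ha'' (by linarith))]
    have hz : 0 ≤ ∫ t in ((2 + β) ^ 2)..(a / 2), Real.log (t / β) ^ (A - 1) := by
      apply intervalIntegral.integral_nonneg ha''
      intro t ht
      have := log_div_pos hβ ht.1
      positivity
    have hone : ∫ _t in (a / 2)..a, Real.log a ^ (A - 1) / (K₁ * 2 ^ |A - 1|) ≤
        ∫ t in (a / 2)..a, Real.log (t / β) ^ (A - 1) := by
      apply intervalIntegral.integral_mono_on (by linarith) (by simp)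
        (hρi _ a ha'' (by linarith))
      intro t ht
      have ht1 := ha''.trans ht.1
      have ht0 : 0 < t := by linarith [ht.1]
      have hlt := one_le_log (h4.trans ht1)
      rw [div_le_iff₀ (by positivity)]
      have hla2 : Real.log a ≤ 2 * Real.log t := by
        rw [← Nat.cast_ofNat, ← Real.log_pow]
        apply Real.log_le_log ha0
        nlinarith [ht.1]
      have hlt2 : Real.log t ≤ 2 * Real.log a := by
        have := Real.log_le_log ht0 ht.2
        linarith
      calc Real.log a ^ (A - 1) ≤ 2 ^ |A - 1| * Real.log t ^ (A - 1) :=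
            rpow_le_mul_rpow _ (by linarith) (by linarith) (by norm_num) hla2 hlt2
        _ ≤ 2 ^ |A - 1| * (K₁ * Real.log (t / β) ^ (A - 1)) := by
            gcongr
            exact (h₁ t ht1).2
        _ = _ := by ring
    rw [intervalIntegral.integral_const, smul_eq_mul] at hone
    calc c * (a / 2) * Real.log a ^ (A - 1) =
          α * ((a - a / 2) * (Real.log a ^ (A - 1) / (K₁ * 2 ^ |A - 1|))) := by
          rw [hc]; ring
      _ ≤ _ := by gcongr; linarith
  have hE := (abs_le.1 (h a ha')).1
  rw [countError] at hE
  have hlA : 0 < Real.log a ^ (A - 1) := by positivity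
  have hE2 : K * (a * Real.log a ^ (A - 1 - B)) ≤ c / 4 * a * Real.log a ^ (A - 1) := by
    rw [Real.rpow_sub (by linarith)]
    have hlB : 0 < Real.log a ^ B := by positivity
    rw [div_le_iff₀ hc0] at h2
    rw [← mul_div_assoc, ← mul_div_assoc, div_le_iff₀ hlB]
    have h0 : 0 < a * Real.log a ^ (A - 1) := by positivity
    nlinarith
  have hlow : (Real.log a)⁻¹ ≤ Real.log a ^ (A - 1) := by
    rw [← Real.rpow_neg_one]
    exact Real.rpow_le_rpow_of_exponent_le hla (by linarith)
  have hs := Real.mul_self_sqrt ha0.le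
  have hsp : 0 < Real.sqrt a := Real.sqrt_pos.2 ha0
  calc Real.sqrt a ≤ c / 4 * a * (Real.log a)⁻¹ := by
        rw [← div_eq_mul_inv, le_div_iff₀ (by linarith)]
        nlinarith
    _ ≤ c / 4 * a * Real.log a ^ (A - 1) := by gcongr
    _ ≤ _ := by linarith

/-- If `q_n > a`, then `n` exceeds the number of terms up to `a`, so `log n ≥ (log a) / 2`. -/
lemma half_log_le_log_index (hq : IsWeightSequence q α β A B) {a : ℝ} (ha : 1 ≤ a)
    (hc : Real.sqrt a ≤ count q a) {n : ℕ+} (hn : a < q n) :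
    Real.log a / 2 ≤ Real.log (n : ℝ) := by
  have h1 : count q a ≤ (n : ℕ) := by
    rw [hq.count_eq_card]
    have hsub : hq.upTo a ⊆ Finset.Iio n := by
      intro m hm
      rw [hq.mem_upTo] at hm
      rw [Finset.mem_Iio]
      by_contra hcon
      exact absurd ((hq.mono (not_lt.1 hcon)).trans hm) (not_le.2 hn)
    refine (Finset.card_le_card hsub).trans ?_
    calc (Finset.Iio n).card ≤ (Finset.Icc 1 n).card := by
          apply Finset.card_le_card
          intro m hm
          simp only [Finset.mem_Iio, Finset.mem_Icc] at *
          exact ⟨_root_.one_le, hm.le⟩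
      _ ≤ n := by simp
  rw [← Real.log_sqrt (by linarith)]
  apply Real.log_le_log (Real.sqrt_pos.2 (by linarith))
  exact hc.trans (by exact_mod_cast h1)

end IsWeightSequence

/-! ### Cumulant generating functions of the random variables -/

section Bounded

variable {Ω : Type*} [MeasurableSpace Ω] {P : Measure Ω} [IsProbabilityMeasure P] {X : Ω → ℝ}

lemma integrable_exp_mul_of_bounded (hX : AEMeasurable X P)
    (hb : ∀ᵐ ω ∂P, X ω ∈ Set.Icc (-1 : ℝ) 1) (t : ℝ) :
    Integrable (fun ω => Real.exp (t * X ω)) P :=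
  integrable_exp_mul_of_mem_Icc hX hb

lemma integrable_of_bounded (hX : AEMeasurable X P) (hb : ∀ᵐ ω ∂P, X ω ∈ Set.Icc (-1 : ℝ) 1) :
    Integrable X P := by
  refine Integrable.of_bound hX.aestronglyMeasurable 1 ?_
  filter_upwards [hb] with ω hω
  rw [Real.norm_eq_abs, abs_le]
  exact hω

lemma exp_cgf_of_bounded (hX : AEMeasurable X P) (hb : ∀ᵐ ω ∂P, X ω ∈ Set.Icc (-1 : ℝ) 1)
    (t : ℝ) : Real.exp (cgf X P t) = ∫ ω, Real.exp (t * X ω) ∂P :=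
  exp_cgf (integrable_exp_mul_of_bounded hX hb t)

lemma cgf_le_self (hX : AEMeasurable X P) (hb : ∀ᵐ ω ∂P, X ω ∈ Set.Icc (-1 : ℝ) 1)
    {t : ℝ} (ht : 0 ≤ t) : cgf X P t ≤ t := by
  rw [← Real.exp_le_exp, exp_cgf_of_bounded hX hb]
  calc ∫ ω, Real.exp (t * X ω) ∂P ≤ ∫ _ω, Real.exp t ∂P := by
        apply integral_mono_ae (integrable_exp_mul_of_bounded hX hb t) (integrable_const _)
        filter_upwards [hb] with ω hω
        apply Real.exp_le_exp.2
        nlinarith [hω.2]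
    _ = Real.exp t := by simp

lemma cgf_nonneg_of_mean_zero (hX : AEMeasurable X P)
    (hb : ∀ᵐ ω ∂P, X ω ∈ Set.Icc (-1 : ℝ) 1) (h0 : ∫ ω, X ω ∂P = 0) (t : ℝ) :
    0 ≤ cgf X P t := by
  rw [← Real.one_le_exp_iff, exp_cgf_of_bounded hX hb]
  have hi := integrable_of_bounded hX hb
  calc (1 : ℝ) = ∫ ω, (t * X ω + 1) ∂P := by
        rw [integral_add (hi.const_mul t) (integrable_const _), integral_const_mul, h0]
        simp
    _ ≤ _ := integral_mono ((hi.const_mul t).add (integrable_const _))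
        (integrable_exp_mul_of_bounded hX hb t) fun ω => Real.add_one_le_exp _

lemma cgf_le_sq_of_mean_zero (hX : AEMeasurable X P)
    (hb : ∀ᵐ ω ∂P, X ω ∈ Set.Icc (-1 : ℝ) 1) (h0 : ∫ ω, X ω ∂P = 0) (t : ℝ) :
    cgf X P t ≤ t ^ 2 := by
  have h := (hasSubgaussianMGF_of_mem_Icc_of_integral_eq_zero hX hb h0).cgf_le t
  have e : (((‖(1 : ℝ) - -1‖₊ / 2) ^ 2 : NNReal) : ℝ) = 1 := by
    push_cast
    norm_num
  rw [e] at h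
  nlinarith [sq_nonneg t]

lemma hasDerivAt_cgf_of_bounded (hX : AEMeasurable X P)
    (hb : ∀ᵐ ω ∂P, X ω ∈ Set.Icc (-1 : ℝ) 1) :
    Continuous (deriv (cgf X P)) ∧
      ∀ t, HasDerivAt (cgf X P) (deriv (cgf X P) t) t ∧ |deriv (cgf X P) t| ≤ 1 := by
  have huniv : interior (integrableExpSet X P) = Set.univ := by
    rw [interior_eq_univ, Set.eq_univ_iff_forall]
    exact fun t => integrable_exp_mul_of_bounded hX hb t
  have han : AnalyticOnNhd ℝ (cgf X P) Set.univ := huniv ▸ analyticOnNhd_cgf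
  refine ⟨continuousOn_univ.1 han.deriv.continuousOn,
    fun t => ⟨(han t trivial).differentiableAt.hasDerivAt, ?_⟩⟩
  have hi := integrable_exp_mul_of_bounded hX hb t
  rw [deriv_cgf (by rw [huniv]; trivial), abs_div, abs_of_pos (mgf_pos hi),
    div_le_one (mgf_pos hi), ← Real.norm_eq_abs]
  refine norm_integral_le_of_norm_le hi ?_
  filter_upwards [hb] with ω hω
  rw [norm_mul, Real.norm_of_nonneg (Real.exp_nonneg _), Real.norm_eq_abs]
  have : |X ω| ≤ 1 := abs_le.2 hω
  nlinarith [Real.exp_pos (t * X ω)]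

/-- The comparison `|log E e^{tX} - log E e^{tX'}| ≤ t δ` when `|X - X'| ≤ δ`. -/
lemma abs_cgf_sub_le {X' : Ω → ℝ} (hX : AEMeasurable X P) (hX' : AEMeasurable X' P)
    (hb : ∀ᵐ ω ∂P, X ω ∈ Set.Icc (-1 : ℝ) 1) (hb' : ∀ᵐ ω ∂P, X' ω ∈ Set.Icc (-1 : ℝ) 1)
    {δ : ℝ} (h : ∀ᵐ ω ∂P, |X ω - X' ω| ≤ δ) {t : ℝ} (ht : 0 ≤ t) :
    |cgf X P t - cgf X' P t| ≤ t * δ := by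
  have key : ∀ {Z Z' : Ω → ℝ}, AEMeasurable Z P → AEMeasurable Z' P →
      (∀ᵐ ω ∂P, Z ω ∈ Set.Icc (-1 : ℝ) 1) → (∀ᵐ ω ∂P, Z' ω ∈ Set.Icc (-1 : ℝ) 1) →
      (∀ᵐ ω ∂P, |Z ω - Z' ω| ≤ δ) → cgf Z P t ≤ cgf Z' P t + t * δ := by
    intro Z Z' hZ hZ' hz hz' hδ
    rw [← Real.exp_le_exp, Real.exp_add, exp_cgf_of_bounded hZ hz, exp_cgf_of_bounded hZ' hz',
      ← integral_mul_const]
    apply integral_mono_ae (integrable_exp_mul_of_bounded hZ hz t)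
      ((integrable_exp_mul_of_bounded hZ' hz' t).mul_const _)
    filter_upwards [hδ] with ω hω
    rw [← Real.exp_add]
    apply Real.exp_le_exp.2
    have := (abs_le.1 hω).2
    nlinarith
  have h1 := key hX hX' hb hb' h
  have h2 := key hX' hX hb' hb (by simpa only [abs_sub_comm] using h)
  rw [abs_le]
  constructor <;> linarith

end Bounded

lemma one_add_log_sq_le {t : ℝ} (ht : 1 ≤ t) : (1 + Real.log t) ^ 2 ≤ 16 * Real.sqrt t := by
  have ht0 : 0 < t := by linarith
  have hs : 0 < Real.sqrt t := Real.sqrt_pos.2 ht0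
  have hs' : 0 < Real.sqrt (Real.sqrt t) := Real.sqrt_pos.2 hs
  have h1 := Real.log_le_sub_one_of_pos hs'
  rw [Real.log_sqrt hs.le, Real.log_sqrt ht0.le] at h1
  have h2 := Real.log_nonneg ht
  have h3 := Real.mul_self_sqrt hs.le
  nlinarith

/-- A random variable that comes as close to its maximum `1` as `CRVH` asks has a cumulant
generating function within `O(t / (log t)²)` of `t`. -/
lemma sub_cgf_le_of_lower {Ω : Type*} [MeasurableSpace Ω] {P : Measure Ω}
    [IsProbabilityMeasure P] {X : Ω → ℝ} (hX : AEMeasurable X P)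
    (hb : ∀ᵐ ω ∂P, X ω ∈ Set.Icc (-1 : ℝ) 1) (h0 : ∫ ω, X ω ∂P = 0) {c₁ c₂ : ℝ}
    (hc₁ : 0 < c₁) (hc₂ : 0 < c₂)
    (h : ∀ t : ℝ, 1 ≤ t →
      c₂ * Real.exp (-c₁ * Real.exp (Real.sqrt t)) ≤ P.real {ω | 1 - 1 / t < X ω})
    {t : ℝ} (ht : 1 ≤ t) :
    t - cgf X P t ≤ (4 + 16 * |Real.log c₂| + 32 * c₁) * t / (1 + Real.log t) ^ 2 := by
  have ht0 : 0 < t := by linarith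
  have hl := Real.log_nonneg ht
  have hl2 : 0 < (1 + Real.log t) ^ 2 := by positivity
  have habs := abs_nonneg (Real.log c₂)
  rcases lt_or_ge (Real.log t) 1 with hlt | hlt
  · have := cgf_nonneg_of_mean_zero hX hb h0 t
    rw [le_div_iff₀ hl2]
    have h4 : (1 + Real.log t) ^ 2 ≤ 4 := by nlinarith
    calc (t - cgf X P t) * (1 + Real.log t) ^ 2 ≤ t * 4 := by
          apply mul_le_mul (by linarith) h4 hl2.le ht0.le
      _ ≤ _ := by nlinarith
  -- The choice of `u` makes `e^{√u}` of size `√t`.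
  set u : ℝ := ((1 + Real.log t) / 2) ^ 2 with hu
  have hu1 : 1 ≤ u := by
    rw [hu]; nlinarith
  have hu0 : 0 < u := by linarith
  have hsq : Real.sqrt u = (1 + Real.log t) / 2 := by
    rw [hu, Real.sqrt_sq (by linarith)]
  have hexp : Real.exp (Real.sqrt u) ≤ 2 * Real.sqrt t := by
    have e1 : Real.exp (1 / 2) ≤ 2 := by
      have : Real.exp (1 / 2) * Real.exp (1 / 2) = Real.exp 1 := by
        rw [← Real.exp_add]; norm_num
      nlinarith [Real.exp_one_lt_d9, Real.exp_pos (1 / 2)]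
    have e2 : Real.exp (Real.log t / 2) = Real.sqrt t := by
      rw [← Real.log_sqrt ht0.le, Real.exp_log (Real.sqrt_pos.2 ht0)]
    rw [hsq, add_div, Real.exp_add, e2]
    gcongr
  have hmk : Real.exp (t * (1 - 1 / u)) * P.real {ω | 1 - 1 / u < X ω} ≤
      Real.exp (cgf X P t) := by
    rw [exp_cgf_of_bounded hX hb]
    refine le_trans ?_ (mul_meas_ge_le_integral_of_nonneg
      (Eventually.of_forall fun ω => (Real.exp_pos _).le)
      (integrable_exp_mul_of_bounded hX hb t) (Real.exp (t * (1 - 1 / u))))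
    apply mul_le_mul_of_nonneg_left _ (Real.exp_pos _).le
    refine measureReal_mono (fun ω hω => ?_) (measure_ne_top _ _)
    simp only [Set.mem_ofPred_eq] at hω ⊢
    apply Real.exp_le_exp.2
    gcongr
  have hlow : t * (1 - 1 / u) + Real.log c₂ - c₁ * Real.exp (Real.sqrt u) ≤ cgf X P t := by
    rw [← Real.exp_le_exp]
    refine le_trans ?_ hmk
    have := h u hu1
    calc _ = Real.exp (t * (1 - 1 / u)) * (c₂ * Real.exp (-c₁ * Real.exp (Real.sqrt u))) := by
          rw [show t * (1 - 1 / u) + Real.log c₂ - c₁ * Real.exp (Real.sqrt u) =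
            t * (1 - 1 / u) + (Real.log c₂ + -c₁ * Real.exp (Real.sqrt u)) by ring,
            Real.exp_add, Real.exp_add, Real.exp_log hc₂]
      _ ≤ _ := by gcongr
  have h16 := one_add_log_sq_le ht
  have hst : 0 < Real.sqrt t := Real.sqrt_pos.2 ht0
  have hmul := Real.mul_self_sqrt ht0.le
  have hst1 : 1 ≤ Real.sqrt t := Real.one_le_sqrt.2 ht
  have hu' : t * (1 / u) = 4 * t / (1 + Real.log t) ^ 2 := by
    rw [hu]; field_simp; norm_num
  have hs1 : Real.sqrt t ≤ 16 * t / (1 + Real.log t) ^ 2 := by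
    rw [le_div_iff₀ hl2]; nlinarith
  have hca : -Real.log c₂ ≤ |Real.log c₂| * (16 * t / (1 + Real.log t) ^ 2) := by
    have := neg_abs_le (Real.log c₂)
    nlinarith
  have hcb : c₁ * Real.exp (Real.sqrt u) ≤ c₁ * (2 * (16 * t / (1 + Real.log t) ^ 2)) := by
    gcongr
    linarith
  have e : (4 + 16 * |Real.log c₂| + 32 * c₁) * t / (1 + Real.log t) ^ 2 =
      4 * t / (1 + Real.log t) ^ 2 + |Real.log c₂| * (16 * t / (1 + Real.log t) ^ 2) +
      c₁ * (2 * (16 * t / (1 + Real.log t) ^ 2)) := by ring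
  rw [e, ← hu']
  nlinarith

/-- The properties of the cumulant generating functions `g n` of the `Y(n)`, and of the cumulant
generating function `gl` of their limit, on which the asymptotic analysis rests. -/
structure CumulantBounds (g : ℕ+ → ℝ → ℝ) (gl : ℝ → ℝ) (D c₃ : ℝ) : Prop where
  D_pos : 0 < D
  nonneg : ∀ n t, 0 ≤ t → 0 ≤ g n t
  le_sq : ∀ n t, 0 ≤ t → g n t ≤ t ^ 2
  le_self : ∀ n t, 0 ≤ t → g n t ≤ t
  self_sub_le : ∀ n t, 1 ≤ t → t - g n t ≤ D * t / (1 + Real.log t) ^ 2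
  nonneg' : ∀ t, 0 ≤ t → 0 ≤ gl t
  le_sq' : ∀ t, 0 ≤ t → gl t ≤ t ^ 2
  le_self' : ∀ t, 0 ≤ t → gl t ≤ t
  self_sub_le' : ∀ t, 1 ≤ t → t - gl t ≤ D * t / (1 + Real.log t) ^ 2
  diff : ∀ n : ℕ+, 2 ≤ n → ∀ t, 0 ≤ t → |g n t - gl t| ≤ t * (c₃ / Real.log (n : ℝ) ^ 2)
  continuous_deriv : Continuous (deriv gl)
  hasDerivAt : ∀ t, HasDerivAt gl (deriv gl t) t
  abs_deriv_le : ∀ t, |deriv gl t| ≤ 1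

lemma tendsto_div_log_sq (c₃ : ℝ) :
    Tendsto (fun m : ℕ => c₃ / Real.log ((m.succPNat : ℕ+) : ℝ) ^ 2) atTop (𝓝 0) := by
  have h1 : Tendsto (fun m : ℕ => Real.log ((m : ℝ) + 1)) atTop atTop :=
    Real.tendsto_log_atTop.comp (tendsto_atTop_add_const_right _ 1 tendsto_natCast_atTop_atTop)
  have h2 := ((tendsto_pow_atTop (α := ℝ) (n := 2) (by norm_num)).comp h1).const_div_atTop c₃
  refine h2.congr fun m => ?_
  simp

lemma CRVH.cumulantBounds {Ω Ω' : Type*} [MeasurableSpace Ω] [MeasurableSpace Ω']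
    {P : Measure Ω} [IsProbabilityMeasure P] {P' : Measure Ω'} [IsProbabilityMeasure P']
    {Y : ℕ+ → Ω → ℝ} {Ylim : Ω' → ℝ} {c₁ c₂ c₃ : ℝ} (hc₁ : 0 < c₁) (hc₂ : 0 < c₂)
    (h : CRVH P P' Y Ylim c₁ c₂ c₃) :
    CumulantBounds (fun n => cgf (Y n) P) (cgf Ylim P') (4 + 16 * |Real.log c₂| + 32 * c₁) c₃ := by
  obtain ⟨Y', hY'm, -, hid, happ⟩ := h.approx
  have hl := tendsto_div_log_sq c₃
  have htwo : ∀ᶠ m : ℕ in atTop, (2 : ℕ+) ≤ m.succPNat := by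
    filter_upwards [eventually_ge_atTop 1] with m hm
    rw [← PNat.coe_le_coe]
    simp only [Nat.succPNat_coe]
    change 2 ≤ m.succ
    omega
  -- The limit variable inherits the bound `1` because all the `Y'(n)` have its law.
  have hlimb : ∀ᵐ ω ∂P', Ylim ω ∈ Set.Icc (-1 : ℝ) 1 := by
    have hk : ∀ k : ℕ, ∀ᵐ ω ∂P', |Ylim ω| ≤ 1 + 1 / ((k : ℝ) + 1) := by
      intro k
      obtain ⟨m, hm1, hm2⟩ := ((hl.eventually (gt_mem_nhds
        (show (0 : ℝ) < 1 / ((k : ℝ) + 1) by positivity))).and htwo).exists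
      refine (hid m.succPNat).ae_snd (p := fun x => |x| ≤ 1 + 1 / ((k : ℝ) + 1))
        (measurableSet_le (by fun_prop) (by fun_prop)) ?_
      filter_upwards [h.supported m.succPNat, happ _ hm2] with ω h1 h2
      have h3 := abs_le.1 (h2.trans hm1.le)
      rw [abs_le]
      constructor <;> linarith [h1.1, h1.2]
    filter_upwards [ae_all_iff.2 hk] with ω hω
    rw [Set.mem_Icc, ← abs_le]
    have ht : Tendsto (fun k : ℕ => (1 : ℝ) + 1 / ((k : ℝ) + 1)) atTop (𝓝 (1 + 0)) :=
      tendsto_one_div_add_atTop_nhds_zero_nat.const_add 1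
    rw [add_zero] at ht
    exact ge_of_tendsto' ht hω
  have hY'b : ∀ n, ∀ᵐ ω ∂P, Y' n ω ∈ Set.Icc (-1 : ℝ) 1 := fun n =>
    (hid n).symm.ae_mem_snd measurableSet_Icc hlimb
  have hcgf : ∀ n, cgf (Y' n) P = cgf Ylim P' := by
    intro n
    funext t
    simp only [cgf, mgf_congr_identDistrib (hid n)]
  have hYm : ∀ n, AEMeasurable (Y n) P := fun n => (h.measurable n).aemeasurable
  have hdiff : ∀ n : ℕ+, 2 ≤ n → ∀ t, 0 ≤ t →
      |cgf (Y n) P t - cgf Ylim P' t| ≤ t * (c₃ / Real.log (n : ℝ) ^ 2) := by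
    intro n hn t ht
    rw [← hcgf n]
    exact abs_cgf_sub_le (hYm n) (hY'm n).aemeasurable (h.supported n) (hY'b n) (happ n hn) ht
  have hlim : ∀ t, 0 ≤ t →
      Tendsto (fun m : ℕ => cgf (Y m.succPNat) P t) atTop (𝓝 (cgf Ylim P' t)) := by
    intro t ht
    rw [tendsto_iff_norm_sub_tendsto_zero]
    have h2 := hl.const_mul t
    rw [mul_zero] at h2
    refine squeeze_zero' (Eventually.of_forall fun _ => norm_nonneg _) ?_ h2
    filter_upwards [htwo] with m hm
    exact hdiff _ hm t ht
  have hder := hasDerivAt_cgf_of_bounded h.measurable_lim.aemeasurable hlimb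
  have hnn : ∀ n t, 0 ≤ t → 0 ≤ cgf (Y n) P t := fun n t _ =>
    cgf_nonneg_of_mean_zero (hYm n) (h.supported n) (h.mean_zero n) t
  have hsq : ∀ n t, 0 ≤ t → cgf (Y n) P t ≤ t ^ 2 := fun n t _ =>
    cgf_le_sq_of_mean_zero (hYm n) (h.supported n) (h.mean_zero n) t
  have hlow : ∀ n t, 1 ≤ t → t - cgf (Y n) P t ≤
      (4 + 16 * |Real.log c₂| + 32 * c₁) * t / (1 + Real.log t) ^ 2 := fun n t ht =>
    sub_cgf_le_of_lower (hYm n) (h.supported n) (h.mean_zero n) hc₁ hc₂ (h.lower n) ht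
  exact
    { D_pos := by positivity
      nonneg := hnn
      le_sq := hsq
      le_self := fun n t ht => cgf_le_self (hYm n) (h.supported n) ht
      self_sub_le := hlow
      nonneg' := fun t ht => ge_of_tendsto' (hlim t ht) fun m => hnn _ t ht
      le_sq' := fun t ht => le_of_tendsto' (hlim t ht) fun m => hsq _ t ht
      le_self' := fun t ht => cgf_le_self h.measurable_lim.aemeasurable hlimb ht
      self_sub_le' := fun t ht =>
        le_of_tendsto' ((hlim t (by linarith)).const_sub t) fun m => hlow _ t ht
      diff := hdiff
      continuous_deriv := hder.1
      hasDerivAt := fun t => (hder.2 t).1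
      abs_deriv_le := fun t => (hder.2 t).2 }

/-! ### The integral defining `η` -/

/-- The function `f` of the definition of `η`, in terms of the cumulant generating function:
`g t` for `t < 1` and `g t - t` for `t ≥ 1`. -/
noncomputable def excess (g : ℝ → ℝ) (t : ℝ) : ℝ := if t < 1 then g t else g t - t

lemma f_eq_excess {Ω : Type*} [MeasurableSpace Ω] (P : Measure Ω) (X : Ω → ℝ) :
    f P X = excess (cgf X P) := rfl

/-- The constant `η` attached to a cumulant generating function. -/
noncomputable def etaOf (g : ℝ → ℝ) : ℝ := ∫ u in Set.Ioi (0 : ℝ), excess g u / u ^ 2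

lemma hasDerivAt_one_add_log_inv {u : ℝ} (hu : 1 ≤ u) :
    HasDerivAt (fun u => -(1 + Real.log u)⁻¹) (1 / (u * (1 + Real.log u) ^ 2)) u := by
  have hu0 : 0 < u := by linarith
  have hl := Real.log_nonneg hu
  have h := (((Real.hasDerivAt_log hu0.ne').const_add 1).inv (by linarith)).neg
  refine h.congr_deriv ?_
  field_simp

lemma tendsto_one_add_log_inv :
    Tendsto (fun u => -(1 + Real.log u)⁻¹) atTop (𝓝 0) := by
  rw [← neg_zero]
  exact ((tendsto_atTop_add_const_left _ 1 Real.tendsto_log_atTop).inv_tendsto_atTop).neg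

lemma integrableOn_inv_mul_log_sq {x : ℝ} (hx : 1 ≤ x) :
    IntegrableOn (fun u : ℝ => 1 / (u * (1 + Real.log u) ^ 2)) (Set.Ioi x) ∧
      ∫ u in Set.Ioi x, 1 / (u * (1 + Real.log u) ^ 2) = 1 / (1 + Real.log x) := by
  have hc := (hasDerivAt_one_add_log_inv hx).continuousAt.continuousWithinAt (s := Set.Ici x)
  have hd : ∀ u ∈ Set.Ioi x,
      HasDerivAt (fun u => -(1 + Real.log u)⁻¹) (1 / (u * (1 + Real.log u) ^ 2)) u :=
    fun u hu => hasDerivAt_one_add_log_inv (hx.trans (le_of_lt hu))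
  have hi := integrableOn_Ioi_deriv_of_nonneg hc hd
    (fun u hu => by
      have : 0 < u := by linarith [Set.mem_Ioi.1 hu]
      positivity) tendsto_one_add_log_inv
  refine ⟨hi, ?_⟩
  rw [integral_Ioi_of_hasDerivAt_of_tendsto hc hd hi tendsto_one_add_log_inv]
  simp

namespace CumulantBounds

variable {g : ℕ+ → ℝ → ℝ} {gl : ℝ → ℝ} {D c₃ : ℝ}

lemma continuous_lim (h : CumulantBounds g gl D c₃) : Continuous gl :=
  continuous_iff_continuousAt.2 fun t => (h.hasDerivAt t).continuousAt

lemma measurable_excess (h : CumulantBounds g gl D c₃) : Measurable (excess gl) :=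
  Measurable.ite measurableSet_Iio h.continuous_lim.measurable
    (h.continuous_lim.measurable.sub measurable_id)

lemma abs_excess_le_sq (h : CumulantBounds g gl D c₃) {t : ℝ} (h0 : 0 ≤ t) (h1 : t < 1) :
    |excess gl t| ≤ t ^ 2 := by
  rw [excess, if_pos h1, abs_of_nonneg (h.nonneg' t h0)]
  exact h.le_sq' t h0

lemma abs_excess_le_log (h : CumulantBounds g gl D c₃) {t : ℝ} (h1 : 1 ≤ t) :
    |excess gl t| ≤ D * t / (1 + Real.log t) ^ 2 := by
  rw [excess, if_neg (not_lt.2 h1), abs_sub_comm,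
    abs_of_nonneg (sub_nonneg.2 (h.le_self' t (by linarith)))]
  exact h.self_sub_le' t h1

lemma abs_excess_le_self (h : CumulantBounds g gl D c₃) {t : ℝ} (h0 : 0 ≤ t) :
    |excess gl t| ≤ t := by
  rcases lt_or_ge t 1 with h1 | h1
  · exact (h.abs_excess_le_sq h0 h1).trans (by nlinarith)
  · rw [excess, if_neg (not_lt.2 h1), abs_sub_comm,
      abs_of_nonneg (sub_nonneg.2 (h.le_self' t h0))]
    linarith [h.nonneg' t h0]

lemma measurable_excess_div (h : CumulantBounds g gl D c₃) :
    Measurable fun u => excess gl u / u ^ 2 :=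
  h.measurable_excess.div (by fun_prop)

lemma norm_excess_div_le_one (h : CumulantBounds g gl D c₃) {u : ℝ} (h0 : 0 < u) (h1 : u < 1) :
    ‖excess gl u / u ^ 2‖ ≤ 1 := by
  rw [Real.norm_eq_abs, abs_div, abs_of_pos (by positivity : (0 : ℝ) < u ^ 2),
    div_le_one (by positivity)]
  exact h.abs_excess_le_sq h0.le h1

lemma norm_excess_div_le (h : CumulantBounds g gl D c₃) {u : ℝ} (h1 : 1 ≤ u) :
    ‖excess gl u / u ^ 2‖ ≤ D * (1 / (u * (1 + Real.log u) ^ 2)) := by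
  have h0 : 0 < u := by linarith
  have hl := Real.log_nonneg h1
  rw [Real.norm_eq_abs, abs_div, abs_of_pos (by positivity : (0 : ℝ) < u ^ 2),
    div_le_iff₀ (by positivity)]
  refine (h.abs_excess_le_log h1).trans (le_of_eq ?_)
  field_simp

lemma integrableOn_excess_Ioo (h : CumulantBounds g gl D c₃) {x : ℝ} (hx : x ≤ 1) :
    IntegrableOn (fun u => excess gl u / u ^ 2) (Set.Ioo 0 x) := by
  refine Measure.integrableOn_of_bounded (M := 1) (by simp)
    h.measurable_excess_div.aestronglyMeasurable ?_
  refine (ae_restrict_iff' measurableSet_Ioo).2 (Eventually.of_forall fun u hu => ?_)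
  exact h.norm_excess_div_le_one hu.1 (hu.2.trans_le hx)

lemma integrableOn_excess_Ici (h : CumulantBounds g gl D c₃) {x : ℝ} (hx : 1 ≤ x) :
    IntegrableOn (fun u => excess gl u / u ^ 2) (Set.Ici x) := by
  rw [integrableOn_Ici_iff_integrableOn_Ioi]
  refine Integrable.mono' ((integrableOn_inv_mul_log_sq hx).1.const_mul D)
    h.measurable_excess_div.aestronglyMeasurable ?_
  refine (ae_restrict_iff' measurableSet_Ioi).2 (Eventually.of_forall fun u hu => ?_)
  exact h.norm_excess_div_le (hx.trans (le_of_lt hu))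

lemma abs_integral_excess_Ioo_le (h : CumulantBounds g gl D c₃) {x : ℝ} (h0 : 0 ≤ x)
    (hx : x ≤ 1) : |∫ u in Set.Ioo 0 x, excess gl u / u ^ 2| ≤ x := by
  have := norm_setIntegral_le_of_norm_le_const (μ := volume) (s := Set.Ioo 0 x)
    (f := fun u => excess gl u / u ^ 2) (C := 1) (by simp)
    (fun u hu => h.norm_excess_div_le_one hu.1 (hu.2.trans_le hx))
  simpa [h0] using this

lemma abs_integral_excess_Ici_le (h : CumulantBounds g gl D c₃) {x : ℝ} (hx : 1 ≤ x) :
    |∫ u in Set.Ici x, excess gl u / u ^ 2| ≤ D / (1 + Real.log x) := by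
  have hi := integrableOn_inv_mul_log_sq hx
  rw [integral_Ici_eq_integral_Ioi, ← Real.norm_eq_abs]
  refine (norm_integral_le_of_norm_le (hi.1.const_mul D)
    ((ae_restrict_iff' measurableSet_Ioi).2 (Eventually.of_forall fun u hu =>
      h.norm_excess_div_le (hx.trans (le_of_lt hu))))).trans (le_of_eq ?_)
  rw [integral_const_mul, hi.2]
  ring

lemma integrableOn_excess (h : CumulantBounds g gl D c₃) :
    IntegrableOn (fun u => excess gl u / u ^ 2) (Set.Ioi 0) := by
  rw [← Set.Ioo_union_Ici_eq_Ioi (show (0 : ℝ) < 1 by norm_num)]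
  exact (h.integrableOn_excess_Ioo le_rfl).union (h.integrableOn_excess_Ici le_rfl)

lemma integral_excess_sub_etaOf_le (h : CumulantBounds g gl D c₃) {x y : ℝ} (h0 : 0 < x)
    (hx : x ≤ 1) (hy : 1 ≤ y) :
    |(∫ u in Set.Ico x y, excess gl u / u ^ 2) - etaOf gl| ≤ x + D / (1 + Real.log y) := by
  have hd : Set.Ioi (0 : ℝ) = (Set.Ioo 0 x ∪ Set.Ico x y) ∪ Set.Ici y := by
    rw [Set.Ioo_union_Ico_eq_Ioo h0 (hx.trans hy), Set.Ioo_union_Ici_eq_Ioi (by linarith)]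
  have hint := h.integrableOn_excess
  have e : etaOf gl = (∫ u in Set.Ioo 0 x, excess gl u / u ^ 2) +
      (∫ u in Set.Ico x y, excess gl u / u ^ 2) + ∫ u in Set.Ici y, excess gl u / u ^ 2 := by
    rw [etaOf, hd, setIntegral_union _ measurableSet_Ici,
      setIntegral_union _ measurableSet_Ico]
    · exact h.integrableOn_excess_Ioo hx
    · exact hint.mono_set fun u hu => h0.trans_le hu.1
    · rw [Set.disjoint_left]
      exact fun u hu hu' => absurd hu.2 (not_lt.2 hu'.1)
    · apply hint.mono_set
      rw [hd]
      exact Set.subset_union_left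
    · exact h.integrableOn_excess_Ici hy
    · rw [Set.disjoint_left]
      rintro u (hu | hu) hu'
      · exact absurd (hu.2.trans_le (hx.trans hy)) (not_lt.2 hu')
      · exact absurd hu.2 (not_lt.2 hu')
  have h1 := abs_le.1 (h.abs_integral_excess_Ioo_le h0.le hx)
  have h2 := abs_le.1 (h.abs_integral_excess_Ici_le hy)
  rw [e, abs_le]
  constructor <;> linarith [h1.1, h1.2, h2.1, h2.2]

lemma abs_etaOf_le (h : CumulantBounds g gl D c₃) : |etaOf gl| ≤ 1 + D := by
  have := h.integral_excess_sub_etaOf_le one_pos le_rfl le_rfl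
  simpa using this

/-- The substitution `u = s / t` in the integral defining `η`. -/
lemma integral_excess_comp_div (gl : ℝ → ℝ) {s a R : ℝ} (hs : 0 < s) (ha : 0 < a)
    (haR : a ≤ R) :
    ∫ t in a..R, excess gl (s / t) = s * ∫ u in Set.Ico (s / R) (s / a), excess gl u / u ^ 2 := by
  have himg : (fun t => s / t) '' Set.Ioc a R = Set.Ico (s / R) (s / a) := by
    ext u
    simp only [Set.mem_image, Set.mem_Ioc, Set.mem_Ico]
    constructor
    · rintro ⟨t, ⟨h1, h2⟩, rfl⟩
      have ht : 0 < t := ha.trans h1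
      exact ⟨by gcongr, by gcongr⟩
    · rintro ⟨h1, h2⟩
      have hR : 0 < R := ha.trans_le haR
      have hu : 0 < u := lt_of_lt_of_le (by positivity) h1
      refine ⟨s / u, ⟨?_, ?_⟩, by field_simp⟩
      · rw [lt_div_iff₀ hu]
        rw [lt_div_iff₀ ha] at h2
        linarith
      · rw [div_le_iff₀ hu]
        rw [div_le_iff₀ hR] at h1
        linarith
  have hcv := integral_image_eq_integral_abs_deriv_smul (s := Set.Ioc a R)
    (f := fun t => s / t) (f' := fun t => -(s / t ^ 2)) measurableSet_Ioc ?_ ?_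
    (fun u => excess gl u / u ^ 2)
  · rw [himg] at hcv
    rw [hcv, intervalIntegral.integral_of_le haR, ← integral_const_mul]
    apply setIntegral_congr_fun measurableSet_Ioc
    intro t ht
    have ht0 : 0 < t := ha.trans ht.1
    simp only [abs_neg, smul_eq_mul]
    rw [abs_of_pos (by positivity)]
    field_simp
  · intro t ht
    have ht0 : 0 < t := ha.trans ht.1
    have h1 := ((hasDerivAt_inv ht0.ne').const_mul s).hasDerivWithinAt (s := Set.Ioc a R)
    simp only [div_eq_mul_inv]
    refine h1.congr_deriv ?_
    ring
  · intro t ht t' ht' hh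
    have ht0 : 0 < t := ha.trans ht.1
    have ht0' : 0 < t' := ha.trans ht'.1
    simp only at hh
    rw [div_eq_div_iff ht0.ne' ht0'.ne'] at hh
    exact (mul_left_cancel₀ hs.ne' hh).symm

lemma intervalIntegrable_excess_div (h : CumulantBounds g gl D c₃) {s a R : ℝ} (hs : 0 < s)
    (ha : 0 < a) (haR : a ≤ R) :
    IntervalIntegrable (fun t => excess gl (s / t)) volume a R := by
  rw [intervalIntegrable_iff_integrableOn_Ioc_of_le haR]
  refine Measure.integrableOn_of_bounded (M := s / a) (by simp)
    (h.measurable_excess.comp (by fun_prop)).aestronglyMeasurable ?_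
  refine (ae_restrict_iff' measurableSet_Ioc).2 (Eventually.of_forall fun t ht => ?_)
  have ht0 : 0 < t := ha.trans ht.1
  refine (h.abs_excess_le_self (by positivity)).trans ?_
  have := ht.1.le
  gcongr

/-- The integral of `|f(s/t)| |log(s/t)|` over `[a, R]` is `O(s (log (1 + log (s/a)) + log (R/s)))`,
in the form of a bound for weights `ψ` with `|ψ(t)| ≤ k |log(s/t)|`. -/
lemma abs_integral_excess_mul_le (h : CumulantBounds g gl D c₃) {s a R k : ℝ} {ψ : ℝ → ℝ}
    (ha : 0 < a) (has : a ≤ s) (hsR : s ≤ R) (hψ : ContinuousOn ψ (Set.Icc a R))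
    (hk : ∀ t ∈ Set.Icc a R, |ψ t| ≤ k * |Real.log (s / t)|) (hk0 : 0 ≤ k) :
    |∫ t in a..R, excess gl (s / t) * ψ t| ≤
      k * s * (D * Real.log (1 + Real.log (s / a)) + Real.log (R / s)) := by
  have hs : 0 < s := ha.trans_le has
  have hD := h.D_pos
  have hi : ∀ x y : ℝ, a ≤ x → x ≤ y → y ≤ R →
      IntervalIntegrable (fun t => excess gl (s / t) * ψ t) volume x y := by
    intro x y hax hxy hyR
    refine (h.intervalIntegrable_excess_div hs (ha.trans_le hax) hxy).mul_continuousOn ?_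
    rw [Set.uIcc_of_le hxy]
    exact hψ.mono (Set.Icc_subset_Icc hax hyR)
  have h1 : |∫ t in a..s, excess gl (s / t) * ψ t| ≤
      k * s * (D * Real.log (1 + Real.log (s / a))) := by
    have hpos : ∀ t ∈ Set.uIcc a s, 0 < t ∧ 0 ≤ Real.log (s / t) := by
      intro t ht
      rw [Set.uIcc_of_le has] at ht
      have ht0 := ha.trans_le ht.1
      exact ⟨ht0, Real.log_nonneg (by rw [one_le_div ht0]; exact ht.2)⟩
    have hd : ∀ t ∈ Set.uIcc a s, HasDerivAt (fun t => -Real.log (1 + Real.log (s / t)))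
        (1 / (t * (1 + Real.log (s / t)))) t := by
      intro t ht
      obtain ⟨ht0, hl⟩ := hpos t ht
      have e1 : HasDerivAt (fun t => s / t) (-(s / t ^ 2)) t := by
        simp only [div_eq_mul_inv]
        refine ((hasDerivAt_inv ht0.ne').const_mul s).congr_deriv ?_
        ring
      have e2 := ((((e1.log (by positivity)).const_add 1).log (by positivity))).neg
      refine e2.congr_deriv ?_
      field_simp
    have hci : IntervalIntegrable (fun t => 1 / (t * (1 + Real.log (s / t)))) volume a s := by
      apply ContinuousOn.intervalIntegrable
      intro t ht
      obtain ⟨ht0, hl⟩ := hpos t ht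
      apply ContinuousAt.continuousWithinAt
      refine ContinuousAt.div continuousAt_const (continuousAt_id.mul
        (continuousAt_const.add (ContinuousAt.log ?_ (by positivity)))) (by positivity)
      exact continuousAt_const.div continuousAt_id ht0.ne'
    have hint := intervalIntegral.integral_eq_sub_of_hasDerivAt hd hci
    rw [← Real.norm_eq_abs]
    refine (intervalIntegral.norm_integral_le_of_norm_le has (Eventually.of_forall ?_)
      (hci.const_mul (k * s * D))).trans (le_of_eq ?_)
    · intro t ht
      have ht' : t ∈ Set.Icc a R := ⟨ht.1.le, ht.2.trans hsR⟩
      obtain ⟨ht0, hl⟩ := hpos t (by rw [Set.uIcc_of_le has]; exact ⟨ht.1.le, ht.2⟩)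
      have h2 := hk t ht'
      rw [abs_of_nonneg hl] at h2
      have h3 := h.abs_excess_le_log (t := s / t) (by rw [one_le_div ht0]; exact ht.2)
      rw [norm_mul, Real.norm_eq_abs, Real.norm_eq_abs]
      calc _ ≤ D * (s / t) / (1 + Real.log (s / t)) ^ 2 * (k * Real.log (s / t)) := by
            gcongr
        _ ≤ D * (s / t) / (1 + Real.log (s / t)) ^ 2 * (k * (1 + Real.log (s / t))) := by
            gcongr
            linarith
        _ = _ := by field_simp
    · rw [intervalIntegral.integral_const_mul, hint, div_self hs.ne']
      simp
      ring
  have h2 : |∫ t in s..R, excess gl (s / t) * ψ t| ≤ k * s * Real.log (R / s) := by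
    have hd : ∀ t ∈ Set.uIcc s R, HasDerivAt Real.log (1 / t) t := by
      intro t ht
      rw [Set.uIcc_of_le hsR] at ht
      simpa using Real.hasDerivAt_log (x := t) (by linarith [ht.1])
    have hci : IntervalIntegrable (fun t : ℝ => 1 / t) volume s R := by
      apply ContinuousOn.intervalIntegrable
      rw [Set.uIcc_of_le hsR]
      apply ContinuousOn.div continuousOn_const (by fun_prop)
      intro t ht
      linarith [ht.1]
    have hint := intervalIntegral.integral_eq_sub_of_hasDerivAt hd hci
    rw [← Real.norm_eq_abs]
    refine (intervalIntegral.norm_integral_le_of_norm_le hsR (Eventually.of_forall ?_)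
      (hci.const_mul (k * s))).trans (le_of_eq ?_)
    · intro t ht
      have ht' : t ∈ Set.Icc a R := ⟨has.trans ht.1.le, ht.2⟩
      have ht0 : 0 < t := hs.trans ht.1
      have h2 := hk t ht'
      have hl : Real.log (s / t) = -Real.log (t / s) := by
        rw [← Real.log_inv, inv_div]
      have hl0 : 0 ≤ Real.log (t / s) := Real.log_nonneg (by rw [one_le_div hs]; exact ht.1.le)
      have hl1 : Real.log (t / s) ≤ t / s := by
        linarith [Real.log_le_sub_one_of_pos (show 0 < t / s by positivity)]
      rw [hl, abs_neg, abs_of_nonneg hl0] at h2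
      have h3 := h.abs_excess_le_sq (t := s / t) (by positivity)
        (by rw [div_lt_one ht0]; exact ht.1)
      rw [norm_mul, Real.norm_eq_abs, Real.norm_eq_abs]
      calc _ ≤ (s / t) ^ 2 * (k * (t / s)) := by
            gcongr
            exact h2.trans (by gcongr)
        _ = _ := by field_simp
    · have hR : 0 < R := hs.trans_le hsR
      rw [intervalIntegral.integral_const_mul, hint, Real.log_div hR.ne' hs.ne']
  rw [← intervalIntegral.integral_add_adjacent_intervals (hi a s le_rfl has hsR)
    (hi s R has hsR le_rfl)]
  refine (abs_add_le _ _).trans ?_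
  rw [mul_add]
  exact add_le_add h1 h2

end CumulantBounds

/-! ### Asymptotics of the logarithmic Laplace transform -/

/-- The relative error `log w / w + w^{1-B}`, whose square root is the error of the theorem. -/
noncomputable def relErr (B w : ℝ) : ℝ := Real.log w / w + w ^ (1 - B)

/-- The error term in the asymptotic formula for the logarithmic Laplace transform at `s`. -/
noncomputable def laplaceErr (A B s : ℝ) : ℝ :=
  s * Real.log s ^ (A - 1) * relErr B (Real.log s)

/-- The inequalities between `√s`, `s` and `s log s` that hold for large `s`. -/
structure IsLarge (a₀ s : ℝ) : Prop where
  four_le : 4 ≤ s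
  le_sqrt : a₀ ≤ Real.sqrt s
  sqrt_le : Real.sqrt s ≤ s
  le_mul_log : s ≤ s * Real.log s
  mul_log_le : s * Real.log s ≤ s ^ 2
  one_le_log_log : 1 ≤ Real.log (Real.log s)

lemma exists_isLarge (a₀ : ℝ) : ∃ s₀ : ℝ, ∀ s : ℝ, s₀ ≤ s → IsLarge a₀ s := by
  have h1 : ∀ᶠ s : ℝ in atTop, a₀ ≤ Real.sqrt s :=
    Real.tendsto_sqrt_atTop.eventually_ge_atTop a₀
  have h2 : ∀ᶠ s : ℝ in atTop, 1 ≤ Real.log (Real.log s) :=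
    (Real.tendsto_log_atTop.comp Real.tendsto_log_atTop).eventually_ge_atTop 1
  obtain ⟨s₀, hs₀⟩ := eventually_atTop.1 ((h1.and h2).and (eventually_ge_atTop (4 : ℝ)))
  refine ⟨s₀, fun s hs => ?_⟩
  obtain ⟨⟨h1, h2⟩, h3⟩ := hs₀ s hs
  have hl := one_le_log h3
  have hl2 := Real.log_le_sub_one_of_pos (show 0 < s by linarith)
  refine ⟨h3, h1, ?_, by nlinarith, by nlinarith, h2⟩
  rw [Real.sqrt_le_left (by linarith)]
  nlinarith

namespace IsLarge

variable {a₀ s A B : ℝ}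

lemma pos (h : IsLarge a₀ s) : 0 < s := by linarith [h.four_le]

lemma one_le_log (h : IsLarge a₀ s) : 1 ≤ Real.log s := LargeDev.one_le_log h.four_le

lemma log_sqrt (h : IsLarge a₀ s) : Real.log (Real.sqrt s) = Real.log s / 2 :=
  Real.log_sqrt h.pos.le

lemma relErr_ge (h : IsLarge a₀ s) :
    1 / Real.log s ≤ relErr B (Real.log s) ∧
      Real.log (Real.log s) / Real.log s ≤ relErr B (Real.log s) ∧
      Real.log s ^ (1 - B) ≤ relErr B (Real.log s) := by
  have hl := h.one_le_log
  have hll := h.one_le_log_log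
  have h1 : 0 ≤ Real.log s ^ (1 - B) := by positivity
  have h2 : 1 / Real.log s ≤ Real.log (Real.log s) / Real.log s := by gcongr
  have h3 : 0 ≤ 1 / Real.log s := by positivity
  unfold relErr
  refine ⟨?_, ?_, ?_⟩ <;> linarith

lemma log_log_le_laplaceErr (h : IsLarge a₀ s) :
    s * (Real.log s ^ (A - 1) * (Real.log (Real.log s) / Real.log s)) ≤ laplaceErr A B s := by
  have hl := h.one_le_log
  have hs := h.pos
  rw [laplaceErr, mul_assoc]
  gcongr
  exact h.relErr_ge.2.1

lemma inv_log_le_laplaceErr (h : IsLarge a₀ s) :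
    s * (Real.log s ^ (A - 1) * (1 / Real.log s)) ≤ laplaceErr A B s := by
  have hl := h.one_le_log
  have hs := h.pos
  rw [laplaceErr, mul_assoc]
  gcongr
  exact h.relErr_ge.1

lemma log_rpow_le_laplaceErr (h : IsLarge a₀ s) :
    s * Real.log s ^ (A - B) ≤ laplaceErr A B s := by
  have hl := h.one_le_log
  have hs := h.pos
  rw [laplaceErr, mul_assoc, show A - B = (A - 1) + (1 - B) by ring,
    Real.rpow_add (by linarith)]
  gcongr
  exact h.relErr_ge.2.2

end IsLarge

namespace IsWeightSequence

variable {q : ℕ+ → ℝ} {α β A B : ℝ}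

/-- The terms with `q_n ≤ √s` are `s / q_n` up to an admissible error. -/
lemma exists_sum_small_le (hq : IsWeightSequence q α β A B) (D c₃ : ℝ) :
    ∃ K s₀ : ℝ, 0 < K ∧ ∀ (g : ℕ+ → ℝ → ℝ) (gl : ℝ → ℝ), CumulantBounds g gl D c₃ →
      ∀ s : ℝ, s₀ ≤ s →
      |∑ n ∈ hq.upTo (Real.sqrt s), g n (s / q n) - s * harmonicSum q (Real.sqrt s)| ≤
        K * laplaceErr A B s := by
  obtain ⟨K, a₀, hK, h⟩ := hq.exists_harmonicSum_le
  obtain ⟨s₀, hs₀⟩ := exists_isLarge a₀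
  have hA := hq.A_nonneg
  refine ⟨4 * (|D| + 1) * K, s₀, by positivity, fun g gl hg s hs => ?_⟩
  have hL := hs₀ s hs
  have hs0 := hL.pos
  have hD := hg.D_pos
  have hll := hL.one_le_log
  have hlll := hL.one_le_log_log
  have hterm : ∀ n ∈ hq.upTo (Real.sqrt s),
      |g n (s / q n) - s * (1 / q n)| ≤ 4 * D * s / Real.log s ^ 2 * (1 / q n) := by
    intro n hn
    rw [hq.mem_upTo] at hn
    have hqn := hq.q_pos n
    have hsq : Real.sqrt s ≤ s / q n := by
      rw [le_div_iff₀ hqn]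
      calc Real.sqrt s * q n ≤ Real.sqrt s * Real.sqrt s := by gcongr
        _ = s := Real.mul_self_sqrt hs0.le
    have h1 : 1 ≤ s / q n := (Real.one_le_sqrt.2 (by linarith [hL.four_le])).trans hsq
    have hlog : Real.log s / 2 ≤ Real.log (s / q n) := by
      rw [← hL.log_sqrt]
      exact Real.log_le_log (Real.sqrt_pos.2 hs0) hsq
    rw [mul_one_div, abs_sub_comm, abs_of_nonneg (sub_nonneg.2 (hg.le_self n _ (by positivity)))]
    calc _ ≤ _ := hg.self_sub_le n _ h1
      _ ≤ D * (s / q n) / (Real.log s / 2) ^ 2 := by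
          gcongr
          linarith
      _ = _ := by field_simp; norm_num
  rw [hq.harmonicSum_eq, Finset.mul_sum, ← Finset.sum_sub_distrib]
  refine (Finset.abs_sum_le_sum_abs _ _).trans ((Finset.sum_le_sum hterm).trans ?_)
  rw [← Finset.mul_sum, ← hq.harmonicSum_eq]
  have h2 := h _ hL.le_sqrt
  have h3 : Real.log (Real.sqrt s) ^ A * Real.log (Real.log (Real.sqrt s)) ≤
      Real.log s ^ A * Real.log (Real.log s) := by
    have h5 := Real.log_le_sub_one_of_pos (show 0 < Real.log s by linarith)
    rw [hL.log_sqrt]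
    exact mul_le_mul (Real.rpow_le_rpow (by linarith) (by linarith) hA)
      (Real.log_le_log (by linarith) (by linarith)) (Real.log_nonneg (by linarith))
      (by positivity)
  have hlA : Real.log s ^ A = Real.log s ^ (A - 1) * Real.log s := by
    rw [← Real.rpow_add_one (by linarith)]; ring_nf
  calc _ ≤ 4 * D * s / Real.log s ^ 2 * (K * (Real.log s ^ A * Real.log (Real.log s))) := by
        gcongr
        exact h2.trans (by gcongr)
    _ = 4 * D * K *
        (s * (Real.log s ^ (A - 1) * (Real.log (Real.log s) / Real.log s))) := by
        rw [hlA]; field_simp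
    _ ≤ 4 * (|D| + 1) * K *
        (s * (Real.log s ^ (A - 1) * (Real.log (Real.log s) / Real.log s))) := by
        gcongr
        linarith [le_abs_self D]
    _ ≤ _ := by
        gcongr
        exact hL.log_log_le_laplaceErr

/-- For `√s < q_n ≤ s log s` the cumulant generating functions may be replaced by the limit. -/
lemma exists_sum_middle_le (hq : IsWeightSequence q α β A B) {D c₃ : ℝ} (hc₃ : 0 < c₃) :
    ∃ K s₀ : ℝ, 0 < K ∧ ∀ (g : ℕ+ → ℝ → ℝ) (gl : ℝ → ℝ), CumulantBounds g gl D c₃ →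
      ∀ s : ℝ, s₀ ≤ s →
      |∑ n ∈ hq.block (Real.sqrt s) (s * Real.log s), g n (s / q n) -
        ∑ n ∈ hq.block (Real.sqrt s) (s * Real.log s), gl (s / q n)| ≤
        K * laplaceErr A B s := by
  obtain ⟨K, hK, h⟩ := hq.exists_sum_block_inv_le
  obtain ⟨a₁, ha₁⟩ := hq.exists_sqrt_le_count
  obtain ⟨s₀, hs₀⟩ := exists_isLarge (max a₁ (2 * (2 + β) ^ 2))
  have hA := hq.A_nonneg
  refine ⟨16 * c₃ * K, s₀, by positivity, fun g gl hg s hs => ?_⟩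
  have hL := hs₀ s hs
  have hs0 := hL.pos
  have hll := hL.one_le_log
  have hlll := hL.one_le_log_log
  have ha1 : a₁ ≤ Real.sqrt s := (le_max_left _ _).trans hL.le_sqrt
  have ha2 : 2 * (2 + β) ^ 2 ≤ Real.sqrt s := (le_max_right _ _).trans hL.le_sqrt
  have hs1 : 1 ≤ Real.sqrt s := Real.one_le_sqrt.2 (by linarith [hL.four_le])
  have hterm : ∀ n ∈ hq.block (Real.sqrt s) (s * Real.log s),
      |g n (s / q n) - gl (s / q n)| ≤ 16 * c₃ * s / Real.log s ^ 2 * (1 / q n) := by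
    intro n hn
    rw [hq.mem_block] at hn
    have hqn := hq.q_pos n
    have hlogn := hq.half_log_le_log_index hs1 (ha₁ _ ha1) hn.1
    rw [hL.log_sqrt] at hlogn
    -- The closeness to the limit variables is not assumed for `n = 1`, where `log n = 0`.
    have hn2 : 2 ≤ n := by
      by_contra hcon
      have : n = 1 := PNat.lt_add_one_iff.1 (not_le.1 hcon) |>.antisymm _root_.one_le
      rw [this] at hlogn
      simp at hlogn
      linarith
    calc _ ≤ s / q n * (c₃ / Real.log (n : ℝ) ^ 2) := hg.diff n hn2 _ (by positivity)
      _ ≤ s / q n * (c₃ / (Real.log s / 2 / 2) ^ 2) := by gcongr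
      _ = _ := by field_simp; norm_num
  rw [← Finset.sum_sub_distrib]
  refine (Finset.abs_sum_le_sum_abs _ _).trans ((Finset.sum_le_sum hterm).trans ?_)
  rw [← Finset.mul_sum]
  have hs4 : Real.sqrt s ^ 4 = s ^ 2 := by
    rw [show 4 = 2 * 2 by norm_num, pow_mul, Real.sq_sqrt hs0.le]
  have h2 := h (Real.sqrt s) (s * Real.log s) ha2 (hL.sqrt_le.trans hL.le_mul_log)
    (by rw [hs4]; exact hL.mul_log_le)
  have h3 : Real.log (Real.sqrt s) ^ A ≤ Real.log s ^ A := by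
    rw [hL.log_sqrt]
    gcongr
    linarith
  have hlA : Real.log s ^ A = Real.log s ^ (A - 1) * Real.log s := by
    rw [← Real.rpow_add_one (by linarith)]; ring_nf
  calc _ ≤ 16 * c₃ * s / Real.log s ^ 2 * (K * Real.log s ^ A) := by
        gcongr
        exact h2.trans (by gcongr)
    _ = 16 * c₃ * K * (s * (Real.log s ^ (A - 1) * (1 / Real.log s))) := by
        rw [hlA]; field_simp
    _ ≤ _ := by
        gcongr
        exact hL.inv_log_le_laplaceErr

/-- The terms with `q_n > s log s` are negligible. -/
lemma exists_sum_large_le (hq : IsWeightSequence q α β A B) (D c₃ : ℝ) :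
    ∃ K s₀ : ℝ, 0 < K ∧ ∀ (g : ℕ+ → ℝ → ℝ) (gl : ℝ → ℝ), CumulantBounds g gl D c₃ →
      ∀ s Q : ℝ, s₀ ≤ s → s * Real.log s ≤ Q →
      |∑ n ∈ hq.block (s * Real.log s) Q, g n (s / q n)| ≤ K * laplaceErr A B s := by
  obtain ⟨K, hK, h⟩ := hq.exists_sum_block_inv_sq_le
  obtain ⟨s₀, hs₀⟩ := exists_isLarge (2 * (2 + β) ^ 2)
  refine ⟨K * 2 ^ |A - 1|, s₀, by positivity, fun g gl hg s Q hs hQ => ?_⟩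
  have hL := hs₀ s hs
  have hs0 := hL.pos
  have hll := hL.one_le_log
  have hb := hL.le_sqrt.trans (hL.sqrt_le.trans hL.le_mul_log)
  have hterm : ∀ n ∈ hq.block (s * Real.log s) Q,
      |g n (s / q n)| ≤ s ^ 2 * (1 / q n ^ 2) := by
    intro n _
    have hqn := hq.q_pos n
    rw [abs_of_nonneg (hg.nonneg n _ (by positivity)), mul_one_div, ← div_pow]
    exact hg.le_sq n _ (by positivity)
  refine (Finset.abs_sum_le_sum_abs _ _).trans ((Finset.sum_le_sum hterm).trans ?_)
  rw [← Finset.mul_sum]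
  have hlR1 : Real.log s ≤ Real.log (s * Real.log s) := Real.log_le_log hs0 hL.le_mul_log
  have hlR2 : Real.log (s * Real.log s) ≤ 2 * Real.log s := by
    have := Real.log_le_log (by positivity) hL.mul_log_le
    rw [Real.log_pow] at this
    exact_mod_cast this
  calc _ ≤ s ^ 2 * (K * (Real.log (s * Real.log s) ^ (A - 1) / (s * Real.log s))) := by
        gcongr
        exact h _ _ hb hQ
    _ ≤ s ^ 2 * (K * (2 ^ |A - 1| * Real.log s ^ (A - 1) / (s * Real.log s))) := by
        gcongr
        exact rpow_le_mul_rpow _ (by linarith) (by linarith) (by norm_num) hlR2 (by linarith)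
    _ = K * 2 ^ |A - 1| * (s * (Real.log s ^ (A - 1) * (1 / Real.log s))) := by field_simp
    _ ≤ _ := by
        gcongr
        exact hL.inv_log_le_laplaceErr

lemma log_sqrt_rpow_le_laplaceErr {a₀ s : ℝ} (hL : IsLarge a₀ s) :
    s * Real.log (Real.sqrt s) ^ (A - B) ≤ 2 ^ |A - B| * laplaceErr A B s := by
  have hs0 := hL.pos
  have hll := hL.one_le_log
  rw [hL.log_sqrt]
  calc _ ≤ s * (2 ^ |A - B| * Real.log s ^ (A - B)) := by
        gcongr
        exact rpow_le_mul_rpow _ (by linarith) (by linarith) (by norm_num) (by linarith)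
          (by linarith)
    _ = 2 ^ |A - B| * (s * Real.log s ^ (A - B)) := by ring
    _ ≤ _ := by
        gcongr
        exact hL.log_rpow_le_laplaceErr

/-- In the range `√s < q_n ≤ s log s` the sum may be replaced by an integral. -/
lemma exists_sum_middle_sub_integral_le (hq : IsWeightSequence q α β A B) (D c₃ : ℝ) :
    ∃ K s₀ : ℝ, 0 < K ∧ ∀ (g : ℕ+ → ℝ → ℝ) (gl : ℝ → ℝ), CumulantBounds g gl D c₃ →
      ∀ s : ℝ, s₀ ≤ s →
      |∑ n ∈ hq.block (Real.sqrt s) (s * Real.log s), gl (s / q n) -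
        ∫ t in (Real.sqrt s)..(s * Real.log s),
          gl (s / t) * (α * Real.log (t / β) ^ (A - 1))| ≤ K * laplaceErr A B s := by
  obtain ⟨K, hK, h⟩ := hq.exists_sum_block_sub_integral_le
  obtain ⟨s₀, hs₀⟩ := exists_isLarge (2 * (2 + β) ^ 2)
  refine ⟨K * 2 ^ |A - B|, s₀, by positivity, fun g gl hg s hs => ?_⟩
  have hL := hs₀ s hs
  have hs0 := hL.pos
  have hpos : ∀ t ∈ Set.Icc (Real.sqrt s) (s * Real.log s), 0 < t := fun t ht =>
    (Real.sqrt_pos.2 hs0).trans_le ht.1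
  refine (h _ _ s (fun t => gl (s / t)) (fun t => deriv gl (s / t) * (-(s / t ^ 2)))
    hL.le_sqrt (hL.sqrt_le.trans hL.le_mul_log) ?_ ?_ ?_ ?_).trans ?_
  · intro t ht
    have ht0 := hpos t ht
    have e1 : HasDerivAt (fun t => s / t) (-(s / t ^ 2)) t := by
      simp only [div_eq_mul_inv]
      refine ((hasDerivAt_inv ht0.ne').const_mul s).congr_deriv ?_
      ring
    exact (hg.hasDerivAt (s / t)).comp t e1
  · have hc : ContinuousOn (fun t : ℝ => s / t) (Set.Icc (Real.sqrt s) (s * Real.log s)) :=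
      continuousOn_const.div continuousOn_id fun t ht => (hpos t ht).ne'
    refine (hg.continuous_deriv.comp_continuousOn hc).mul (ContinuousOn.neg ?_)
    exact continuousOn_const.div (by fun_prop) fun t ht => (pow_pos (hpos t ht) 2).ne'
  · intro t ht
    have ht0 := hpos t ht
    rw [abs_of_nonneg (hg.nonneg' _ (by positivity))]
    exact hg.le_self' _ (by positivity)
  · intro t ht
    have ht0 := hpos t ht
    rw [abs_mul, abs_neg, abs_of_pos (by positivity : 0 < s / t ^ 2)]
    have := hg.abs_deriv_le (s / t)
    have : 0 < s / t ^ 2 := by positivity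
    nlinarith
  · calc _ = K * (s * Real.log (Real.sqrt s) ^ (A - B)) := by ring
      _ ≤ K * (2 ^ |A - B| * laplaceErr A B s) := by
          exact mul_le_mul_of_nonneg_left (log_sqrt_rpow_le_laplaceErr hL) (by positivity)
      _ = _ := by ring

/-- The density `α log(t/β)^{A-1}` varies slowly around `s`. -/
lemma exists_density_sub_le (hq : IsWeightSequence q α β A B) :
    ∃ K : ℝ, 0 < K ∧ ∀ s t : ℝ, (2 + β) ^ 2 ≤ Real.sqrt s → Real.sqrt s ≤ s →
      Real.sqrt s ≤ t → t ≤ s ^ 2 →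
      |α * Real.log (t / β) ^ (A - 1) - α * Real.log (s / β) ^ (A - 1)| ≤
        K * Real.log s ^ (A - 2) * |Real.log (s / t)| := by
  have hβ := hq.beta_pos
  have hα := hq.alpha_pos
  have h4 := hq.four_le_sq
  set k : ℝ := 2 + |Real.log β| with hk
  have hk2 : 2 ≤ k := by linarith [abs_nonneg (Real.log β)]
  refine ⟨α * ((|A - 1| + 1) * (4 * k) ^ |A - 2|), by positivity, fun s t h1 h2 h3 h5 => ?_⟩
  have hs0 : 0 < s := by linarith
  have ht0 : 0 < t := by linarith
  have hls : 1 ≤ Real.log s := one_le_log (by linarith)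
  have hmem : ∀ t, Real.sqrt s ≤ t → t ≤ s ^ 2 →
      Real.log (t / β) ∈ Set.Icc (Real.log s / 4) (k * (2 * Real.log s)) := by
    intro t h3 h5
    have ht0 : 0 < t := by linarith
    obtain ⟨-, l1, l2, l3⟩ := log_div_bounds hβ (h1.trans h3)
    have l4 := Real.log_le_log (by linarith) h3
    rw [Real.log_sqrt hs0.le] at l4
    have l5 := Real.log_le_log ht0 h5
    rw [Real.log_pow] at l5
    push_cast at l5
    refine ⟨by linarith, l3.trans ?_⟩
    gcongr
  have hpos : ∀ x ∈ Set.Icc (Real.log s / 4) (k * (2 * Real.log s)), 0 < x := fun x hx => by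
    linarith [hx.1]
  have hmvt := Convex.norm_image_sub_le_of_norm_hasDerivWithin_le
    (f := fun x : ℝ => x ^ (A - 1)) (f' := fun x => (A - 1) * x ^ (A - 1 - 1))
    (s := Set.Icc (Real.log s / 4) (k * (2 * Real.log s)))
    (C := (|A - 1| + 1) * (4 * k) ^ |A - 2| * Real.log s ^ (A - 2))
    (fun x hx => (Real.hasDerivAt_rpow_const (Or.inl (hpos x hx).ne')).hasDerivWithinAt)
    (fun x hx => by
      have hx0 := hpos x hx
      rw [Real.norm_eq_abs, abs_mul, abs_of_pos (by positivity : 0 < x ^ (A - 1 - 1)), mul_assoc,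
        show A - 1 - 1 = A - 2 by ring]
      gcongr
      · linarith
      · refine rpow_le_mul_rpow _ hx0 (by linarith) (by linarith) ?_ ?_
        · nlinarith [hx.2]
        · nlinarith [hx.1])
    (convex_Icc _ _) (hmem s h2 (by nlinarith)) (hmem t h3 h5)
  have hlog : |Real.log (t / β) - Real.log (s / β)| = |Real.log (s / t)| := by
    rw [Real.log_div ht0.ne' hβ.ne', Real.log_div hs0.ne' hβ.ne', Real.log_div hs0.ne' ht0.ne',
      abs_sub_comm]
    congr 1
    ring
  rw [← mul_sub, abs_mul, abs_of_pos hα]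
  rw [Real.norm_eq_abs, Real.norm_eq_abs, hlog] at hmvt
  calc _ ≤ _ := mul_le_mul_of_nonneg_left hmvt hα.le
    _ = _ := by ring

lemma integral_lim_eq (hq : IsWeightSequence q α β A B) {g : ℕ+ → ℝ → ℝ} {gl : ℝ → ℝ}
    {D c₃ s a R : ℝ} (hg : CumulantBounds g gl D c₃) (ha : (2 + β) ^ 2 ≤ a) (has : a ≤ s)
    (hsR : s ≤ R) :
    ∫ t in a..R, gl (s / t) * (α * Real.log (t / β) ^ (A - 1)) =
      s * (harmonicMain α β A s - harmonicMain α β A a) +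
        ∫ t in a..R, excess gl (s / t) * (α * Real.log (t / β) ^ (A - 1)) := by
  have h4 := hq.four_le_sq
  have ha0 : 0 < a := by linarith
  have hs0 : 0 < s := by linarith
  have hie : ∀ x y : ℝ, a ≤ x → x ≤ y →
      IntervalIntegrable (fun t => excess gl (s / t) * (α * Real.log (t / β) ^ (A - 1)))
        volume x y := by
    intro x y hax hxy
    refine (hg.intervalIntegrable_excess_div hs0 (ha0.trans_le hax) hxy).mul_continuousOn ?_
    rw [Set.uIcc_of_le hxy]
    exact hq.continuousOn_density (ha.trans hax)
  have hig : ∀ x y : ℝ, a ≤ x → x ≤ y →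
      IntervalIntegrable (fun t => gl (s / t) * (α * Real.log (t / β) ^ (A - 1)))
        volume x y := by
    intro x y hax hxy
    apply ContinuousOn.intervalIntegrable
    rw [Set.uIcc_of_le hxy]
    refine ContinuousOn.mul (hg.continuous_lim.comp_continuousOn ?_)
      (hq.continuousOn_density (ha.trans hax))
    exact continuousOn_const.div continuousOn_id fun t ht => by
      linarith [ht.1]
  have hii : IntervalIntegrable (fun t => 1 / t * (α * Real.log (t / β) ^ (A - 1)))
      volume a s := by
    apply ContinuousOn.intervalIntegrable
    rw [Set.uIcc_of_le has]
    refine ContinuousOn.mul ?_ (hq.continuousOn_density ha)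
    exact continuousOn_const.div continuousOn_id fun t ht => by
      linarith [ht.1]
  rw [← intervalIntegral.integral_add_adjacent_intervals (hie a s le_rfl has) (hie s R has hsR),
    ← intervalIntegral.integral_add_adjacent_intervals (hig a s le_rfl has) (hig s R has hsR),
    ← hq.integral_density_div ha has, ← add_assoc, ← intervalIntegral.integral_const_mul,
    ← intervalIntegral.integral_add (hii.const_mul s) (hie a s le_rfl has)]
  congr 1
  · apply intervalIntegral.integral_congr
    intro t ht
    rw [Set.uIcc_of_le has] at ht
    have ht0 : 0 < t := ha0.trans_le ht.1
    simp only
    rw [excess, if_neg (not_lt.2 (by rw [one_le_div ht0]; exact ht.2))]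
    ring
  · rw [intervalIntegral.integral_of_le hsR, intervalIntegral.integral_of_le hsR]
    apply setIntegral_congr_fun measurableSet_Ioc
    intro t ht
    have ht0 : 0 < t := hs0.trans ht.1
    simp only
    rw [excess, if_pos (by rw [div_lt_one ht0]; exact ht.1)]

/-- The integral of `f(s/t)` against the density is asymptotic to `η s` times the density
at `s`. -/
lemma exists_integral_excess_le (hq : IsWeightSequence q α β A B) (D c₃ : ℝ) :
    ∃ K s₀ : ℝ, 0 < K ∧ ∀ (g : ℕ+ → ℝ → ℝ) (gl : ℝ → ℝ), CumulantBounds g gl D c₃ →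
      ∀ s : ℝ, s₀ ≤ s →
      |(∫ t in (Real.sqrt s)..(s * Real.log s),
          excess gl (s / t) * (α * Real.log (t / β) ^ (A - 1))) -
        α * Real.log (s / β) ^ (A - 1) * s * etaOf gl| ≤ K * laplaceErr A B s := by
  obtain ⟨K, hK, h⟩ := hq.exists_density_sub_le
  obtain ⟨K₁, hK₁, h₁⟩ := hq.exists_density_le
  obtain ⟨s₀, hs₀⟩ := exists_isLarge ((2 + β) ^ 2)
  refine ⟨K * (|D| + 1) + K₁ * (1 + 2 * |D|), s₀, by positivity, fun g gl hg s hs => ?_⟩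
  have hL := hs₀ s hs
  have hs0 := hL.pos
  have hll := hL.one_le_log
  have hlll := hL.one_le_log_log
  have hD := hg.D_pos
  have h4 := hq.four_le_sq
  have hsq := Real.sqrt_pos.2 hs0
  set a := Real.sqrt s with ha
  set R := s * Real.log s with hR
  have hR0 : 0 < R := by positivity
  have haR : a ≤ R := hL.sqrt_le.trans hL.le_mul_log
  have hsa : Real.log (s / a) = Real.log s / 2 := by
    rw [Real.log_div hs0.ne' hsq.ne', hL.log_sqrt]; ring
  have hRs : R / s = Real.log s := by rw [hR]; field_simp
  set c : ℝ := α * Real.log (s / β) ^ (A - 1) with hc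
  have hcs : (2 + β) ^ 2 ≤ s := hL.le_sqrt.trans hL.sqrt_le
  have hc0 : 0 < c := hq.density_pos hcs
  have hc1 : c ≤ K₁ * Real.log s ^ (A - 1) := h₁ s hcs
  have hie := hg.intervalIntegrable_excess_div hs0 hsq haR
  have hψ : ContinuousOn (fun t => α * Real.log (t / β) ^ (A - 1) - c) (Set.Icc a R) :=
    (hq.continuousOn_density hL.le_sqrt).sub continuousOn_const
  have hsplit : (∫ t in a..R, excess gl (s / t) * (α * Real.log (t / β) ^ (A - 1))) =
      (∫ t in a..R, excess gl (s / t) * (α * Real.log (t / β) ^ (A - 1) - c)) +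
      (∫ t in a..R, excess gl (s / t)) * c := by
    rw [← intervalIntegral.integral_mul_const, ← intervalIntegral.integral_add
      (hie.mul_continuousOn (by rwa [Set.uIcc_of_le haR])) (hie.mul_const c)]
    congr 1
    funext t
    ring
  have hE1 := hg.abs_integral_excess_mul_le (k := K * Real.log s ^ (A - 2)) hsq hL.sqrt_le
    hL.le_mul_log hψ (fun t ht => h s t hL.le_sqrt hL.sqrt_le ht.1 (ht.2.trans hL.mul_log_le))
    (by positivity)
  have hl1 : Real.log (1 + Real.log (s / a)) ≤ Real.log (Real.log s) := by
    rw [hsa]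
    have h2 : 2 ≤ Real.log s := by
      have := Real.log_le_sub_one_of_pos (show 0 < Real.log s by linarith)
      linarith
    apply Real.log_le_log (by linarith)
    linarith
  rw [hRs] at hE1
  have hA2 : Real.log s ^ (A - 2) = Real.log s ^ (A - 1) / Real.log s := by
    rw [← Real.rpow_sub_one (by linarith)]; ring_nf
  have hE1' : K * Real.log s ^ (A - 2) * s *
      (D * Real.log (1 + Real.log (s / a)) + Real.log (Real.log s)) ≤
      K * (|D| + 1) * laplaceErr A B s := by
    calc _ ≤ K * Real.log s ^ (A - 2) * s *
          (|D| * Real.log (Real.log s) + Real.log (Real.log s)) := by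
          gcongr
          · exact Real.log_nonneg (by rw [hsa]; linarith)
          · exact le_abs_self D
      _ = K * (|D| + 1) *
          (s * (Real.log s ^ (A - 1) * (Real.log (Real.log s) / Real.log s))) := by
          rw [hA2]; field_simp
      _ ≤ _ := by
          gcongr
          exact hL.log_log_le_laplaceErr
  have hE2 := hg.integral_excess_sub_etaOf_le (x := s / R) (y := s / a) (by positivity)
    (by rw [div_le_one hR0]; exact hL.le_mul_log) (by rw [one_le_div hsq]; exact hL.sqrt_le)
  rw [CumulantBounds.integral_excess_comp_div gl hs0 hsq haR] at hsplit
  have hsR : s / R = 1 / Real.log s := by rw [hR]; field_simp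
  have hE2' : s / R + D / (1 + Real.log (s / a)) ≤ (1 + 2 * |D|) * (1 / Real.log s) := by
    have : D / (1 + Real.log (s / a)) ≤ |D| / (Real.log s / 2) := by
      rw [hsa]
      gcongr
      · exact le_abs_self D
      · linarith
    rw [hsR]
    calc _ ≤ 1 / Real.log s + |D| / (Real.log s / 2) := by linarith
      _ = _ := by field_simp
  rw [hsplit]
  set J := ∫ u in Set.Ico (s / R) (s / a), excess gl u / u ^ 2 with hJ
  have e : ∀ I : ℝ, I + s * J * c - c * s * etaOf gl = I + c * s * (J - etaOf gl) := by
    intro I; ring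
  rw [e, add_mul]
  refine (abs_add_le _ _).trans (add_le_add (hE1.trans hE1') ?_)
  rw [abs_mul, abs_of_pos (by positivity : 0 < c * s)]
  calc _ ≤ K₁ * Real.log s ^ (A - 1) * s * ((1 + 2 * |D|) * (1 / Real.log s)) := by
        gcongr
        exact hE2.trans hE2'
    _ = K₁ * (1 + 2 * |D|) * (s * (Real.log s ^ (A - 1) * (1 / Real.log s))) := by ring
    _ ≤ _ := by
        gcongr
        exact hL.inv_log_le_laplaceErr

/-- The asymptotic formula for the logarithm of the Laplace transform of `∑_{q_n ≤ Q} Y(n)/q_n`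
at `s`, as long as `s log s ≤ Q`. -/
lemma exists_laplace_asymptotic (hq : IsWeightSequence q α β A B) {CA D c₃ : ℝ}
    (hCA : Tendsto (fun y => harmonicSum q y - harmonicMain α β A y) atTop (𝓝 CA))
    (hc₃ : 0 < c₃) :
    ∃ K s₀ : ℝ, 0 < K ∧ ∀ (g : ℕ+ → ℝ → ℝ) (gl : ℝ → ℝ), CumulantBounds g gl D c₃ →
      ∀ s Q : ℝ, s₀ ≤ s → s * Real.log s ≤ Q →
      |∑ n ∈ hq.upTo Q, g n (s / q n) - s * (harmonicMain α β A s + CA) -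
        α * Real.log (s / β) ^ (A - 1) * s * etaOf gl| ≤ K * laplaceErr A B s := by
  obtain ⟨CA', K₀, hK₀, hCA', h₀⟩ := hq.exists_harmonicSum_limit
  obtain rfl := tendsto_nhds_unique hCA hCA'
  obtain ⟨K₁, s₁, hK₁, h₁⟩ := hq.exists_sum_small_le D c₃
  obtain ⟨K₂, s₂, hK₂, h₂⟩ := hq.exists_sum_middle_le (D := D) hc₃
  obtain ⟨K₃, s₃, hK₃, h₃⟩ := hq.exists_sum_large_le D c₃
  obtain ⟨K₄, s₄, hK₄, h₄⟩ := hq.exists_sum_middle_sub_integral_le D c₃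
  obtain ⟨K₅, s₅, hK₅, h₅⟩ := hq.exists_integral_excess_le D c₃
  obtain ⟨s₆, h₆⟩ := exists_isLarge (2 * (2 + β) ^ 2)
  refine ⟨K₀ * 2 ^ |A - B| + K₁ + K₂ + K₃ + K₄ + K₅, max (max (max s₁ s₂) (max s₃ s₄)) (max s₅ s₆),
    by positivity, fun g gl hg s Q hs hQ => ?_⟩
  simp only [max_le_iff] at hs
  obtain ⟨⟨⟨hs1, hs2⟩, hs3, hs4⟩, hs5, hs6⟩ := hs
  have hL := h₆ s hs6
  have e1 := h₁ g gl hg s hs1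
  have e2 := h₂ g gl hg s hs2
  have e3 := h₃ g gl hg s Q hs3 hQ
  have e4 := h₄ g gl hg s hs4
  have e5 := h₅ g gl hg s hs5
  have hsR := hL.le_mul_log
  have has := hL.sqrt_le
  have e0 := h₀ _ hL.le_sqrt
  have hs0 := hL.pos
  have e0' : |s * (harmonicSum q (Real.sqrt s) - harmonicMain α β A (Real.sqrt s) - CA)| ≤
      K₀ * 2 ^ |A - B| * laplaceErr A B s := by
    rw [abs_mul, abs_of_pos hs0]
    calc _ ≤ s * (K₀ * Real.log (Real.sqrt s) ^ (A - B)) := by gcongr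
      _ = K₀ * (s * Real.log (Real.sqrt s) ^ (A - B)) := by ring
      _ ≤ K₀ * (2 ^ |A - B| * laplaceErr A B s) := by
          exact mul_le_mul_of_nonneg_left (log_sqrt_rpow_le_laplaceErr hL) (by positivity)
      _ = _ := by ring
  have hsq2 : (2 + β) ^ 2 ≤ Real.sqrt s := by
    have := hL.le_sqrt
    have := sq_nonneg (2 + β)
    linarith
  rw [hq.integral_lim_eq hg hsq2 has hsR] at e4
  rw [hq.sum_upTo_eq hQ, hq.sum_upTo_eq (has.trans hsR)]
  rw [abs_le] at *
  constructor <;> nlinarith [e0'.1, e0'.2, e1.1, e1.2, e2.1, e2.2, e3.1, e3.2, e4.1, e4.2,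
    e5.1, e5.2]

end IsWeightSequence

/-! ### Large deviations by exponential tilting -/

section Tilting

variable {Ω : Type*} [MeasurableSpace Ω] {P : Measure Ω} [IsProbabilityMeasure P] {S : Ω → ℝ}

/-- Chernoff's upper bound. -/
lemma measureReal_lt_le_exp (hi : ∀ s, Integrable (fun ω => Real.exp (s * S ω)) P) {s V : ℝ}
    (hs : 0 ≤ s) : P.real {ω | V < S ω} ≤ Real.exp (cgf S P s - s * V) := by
  refine (measureReal_mono (fun ω hω => ?_) (measure_ne_top _ _)).trans
    ((measure_ge_le_exp_cgf V hs (hi s)).trans (le_of_eq ?_))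
  · simp only [Set.mem_ofPred_eq] at hω ⊢
    exact hω.le
  · congr 1; ring

/-- Lower bound by tilting at `s₁`: if under the tilted measure both `S ≤ V` and `S > V₂` have
probability at most `1/4`, which is tested with the parameters `s₀ ≤ s₁ ≤ s₂`, then the interval
`(V, V₂]` carries at least half of the tilted mass. -/
lemma le_measureReal_of_tilting (hS : Measurable S)
    (hi : ∀ s, Integrable (fun ω => Real.exp (s * S ω)) P)
    {s₀ s₁ s₂ V V₂ : ℝ} (h0 : 0 ≤ s₁) (h01 : s₀ ≤ s₁) (h12 : s₁ ≤ s₂)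
    (hlow : (cgf S P s₀ - s₀ * V) - (cgf S P s₁ - s₁ * V) ≤ -Real.log 4)
    (hhigh : (cgf S P s₂ - s₂ * V₂) - (cgf S P s₁ - s₁ * V₂) ≤ -Real.log 4) :
    Real.exp (cgf S P s₁ - s₁ * V₂) / 2 ≤ P.real {ω | V < S ω} := by
  have hmeas : MeasurableSet {ω | V < S ω} := measurableSet_lt measurable_const hS
  have hind : Integrable (Set.indicator {ω | V < S ω} fun _ => (1 : ℝ)) P :=
    (integrable_const _).indicator hmeas
  -- The three summands dominate for `S ≤ V`, for `S > V₂` and in between, respectively.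
  have hpt : ∀ ω, Real.exp (s₁ * S ω) ≤ Real.exp ((s₁ - s₀) * V) * Real.exp (s₀ * S ω) +
      Real.exp (-((s₂ - s₁) * V₂)) * Real.exp (s₂ * S ω) +
      Real.exp (s₁ * V₂) * Set.indicator {ω | V < S ω} (fun _ => (1 : ℝ)) ω := by
    intro ω
    have p1 := Real.exp_pos ((s₁ - s₀) * V + s₀ * S ω)
    have p2 := Real.exp_pos (-((s₂ - s₁) * V₂) + s₂ * S ω)
    have p3 := Real.exp_pos (s₁ * V₂)
    rw [← Real.exp_add, ← Real.exp_add]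
    by_cases hV : V < S ω
    · rw [Set.indicator_of_mem (by exact hV), mul_one]
      rcases le_or_gt (S ω) V₂ with hV2 | hV2
      · have : Real.exp (s₁ * S ω) ≤ Real.exp (s₁ * V₂) :=
          Real.exp_le_exp.2 (by gcongr)
        linarith
      · have : Real.exp (s₁ * S ω) ≤ Real.exp (-((s₂ - s₁) * V₂) + s₂ * S ω) :=
          Real.exp_le_exp.2 (by nlinarith)
        linarith
    · rw [Set.indicator_of_notMem (by exact hV), mul_zero]
      have : Real.exp (s₁ * S ω) ≤ Real.exp ((s₁ - s₀) * V + s₀ * S ω) :=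
        Real.exp_le_exp.2 (by nlinarith [not_lt.1 hV])
      linarith
  have i0 := (hi s₀).const_mul (Real.exp ((s₁ - s₀) * V))
  have i2 := (hi s₂).const_mul (Real.exp (-((s₂ - s₁) * V₂)))
  have i1 := hind.const_mul (Real.exp (s₁ * V₂))
  have i02 : Integrable (fun ω => Real.exp ((s₁ - s₀) * V) * Real.exp (s₀ * S ω) +
      Real.exp (-((s₂ - s₁) * V₂)) * Real.exp (s₂ * S ω)) P := i0.add i2
  have i021 : Integrable (fun ω => Real.exp ((s₁ - s₀) * V) * Real.exp (s₀ * S ω) +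
      Real.exp (-((s₂ - s₁) * V₂)) * Real.exp (s₂ * S ω) +
      Real.exp (s₁ * V₂) * Set.indicator {ω | V < S ω} (fun _ => (1 : ℝ)) ω) P := i02.add i1
  have hint := integral_mono (hi s₁) i021 hpt
  rw [integral_add i02 i1, integral_add i0 i2, integral_const_mul,
    integral_const_mul, integral_const_mul, integral_indicator_const _ hmeas, smul_eq_mul,
    mul_one] at hint
  have hexp : ∀ s, ∫ ω, Real.exp (s * S ω) ∂P = Real.exp (cgf S P s) := fun s =>
    (exp_cgf (hi s)).symm
  rw [hexp, hexp, hexp, ← Real.exp_add, ← Real.exp_add] at hint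
  have hquarter : ∀ x y : ℝ, x - y ≤ -Real.log 4 → Real.exp x ≤ Real.exp y / 4 := by
    intro x y hxy
    calc Real.exp x ≤ Real.exp (y - Real.log 4) := Real.exp_le_exp.2 (by linarith)
      _ = _ := by rw [Real.exp_sub, Real.exp_log (by norm_num)]
  have q1 := hquarter ((s₁ - s₀) * V + cgf S P s₀) (cgf S P s₁) (by linarith)
  have q2 := hquarter (-((s₂ - s₁) * V₂) + cgf S P s₂) (cgf S P s₁) (by linarith)
  rw [Real.exp_sub, div_div, div_le_iff₀ (by positivity)]
  nlinarith

end Tilting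

/-- The main term of the harmonic sum as a function of `log(y/β)`. -/
noncomputable def logMain (α A x : ℝ) : ℝ :=
  if A = 0 then α * Real.log x else α / A * x ^ A

lemma harmonicMain_mul_exp {α β A : ℝ} (hβ : 0 < β) (x : ℝ) :
    harmonicMain α β A (β * Real.exp x) = logMain α A x := by
  have : Real.log (β * Real.exp x / β) = x := by
    rw [mul_div_cancel_left₀ _ hβ.ne', Real.log_exp]
  simp [harmonicMain, logMain, this]

/-- `W(V)` inverts the main term: the harmonic sum reaches `V` at about `y = β e^W`. -/
lemma logMain_W {α A CA V : ℝ} (hα : 0 < α) (hA : 0 ≤ A) (hV : 1 + CA ≤ V) :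
    logMain α A (W α A CA V) = V - CA := by
  unfold logMain W
  split_ifs with h
  · rw [Real.log_exp]; field_simp
  · have hA' : 0 < A := lt_of_le_of_ne hA (Ne.symm h)
    have h0 : 0 ≤ A / α * (V - CA) := mul_nonneg (by positivity) (by linarith)
    rw [← Real.rpow_mul h0, one_div_mul_cancel h, Real.rpow_one]
    field_simp

lemma exists_rpow_sub_le (p : ℝ) {T : ℝ} (hT : 0 < T) :
    ∃ K : ℝ, 0 < K ∧ ∀ w x : ℝ, 2 * T ≤ w → |x - w| ≤ T →
      |x ^ p - w ^ p| ≤ K * w ^ (p - 1) := by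
  refine ⟨(|p| + 1) * 2 ^ |p - 1| * T, by positivity, fun w x hw hx => ?_⟩
  have hw0 : 0 < w := by linarith
  have hmem : ∀ y ∈ Set.Icc (w - T) (w + T), 0 < y ∧ y ≤ 2 * w ∧ w ≤ 2 * y := fun y hy =>
    ⟨by linarith [hy.1], by linarith [hy.2], by linarith [hy.1]⟩
  have hx' := abs_le.1 hx
  have hmvt := Convex.norm_image_sub_le_of_norm_hasDerivWithin_le
    (f := fun x : ℝ => x ^ p) (f' := fun x => p * x ^ (p - 1))
    (s := Set.Icc (w - T) (w + T)) (C := (|p| + 1) * (2 ^ |p - 1| * w ^ (p - 1)))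
    (fun y hy => (Real.hasDerivAt_rpow_const (Or.inl (hmem y hy).1.ne')).hasDerivWithinAt)
    (fun y hy => by
      obtain ⟨h1, h2, h3⟩ := hmem y hy
      rw [Real.norm_eq_abs, abs_mul, abs_of_pos (by positivity : 0 < y ^ (p - 1))]
      gcongr
      · linarith
      · exact rpow_le_mul_rpow _ h1 hw0 (by norm_num) h2 h3)
    (convex_Icc _ _) (x := w) (y := x) ⟨by linarith, by linarith⟩
    ⟨by linarith [hx'.1], by linarith [hx'.2]⟩
  rw [Real.norm_eq_abs, Real.norm_eq_abs] at hmvt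
  calc _ ≤ _ := hmvt
    _ ≤ (|p| + 1) * (2 ^ |p - 1| * w ^ (p - 1)) * T := by gcongr
    _ = _ := by ring

lemma exists_logMain_sub_le {α A : ℝ} (hα : 0 < α) {T : ℝ} (hT : 0 < T) :
    ∃ K : ℝ, 0 < K ∧ ∀ w x : ℝ, 2 * T ≤ w → |x - w| ≤ T →
      |logMain α A x - logMain α A w - α * (x - w) * w ^ (A - 1)| ≤ K * w ^ (A - 2) := by
  obtain ⟨K, hK, h⟩ := exists_rpow_sub_le (A - 1) hT
  refine ⟨α * K * T, by positivity, fun w x hw hx => ?_⟩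
  have hx' := abs_le.1 hx
  have hw0 : 0 < w := by linarith
  have hd : ∀ y ∈ Set.Icc (w - T) (w + T),
      HasDerivAt (fun y => logMain α A y - α * y * w ^ (A - 1))
        (α * (y ^ (A - 1) - w ^ (A - 1))) y := by
    intro y hy
    have hy0 : y ≠ 0 := by linarith [hy.1]
    have h1 : HasDerivAt (logMain α A) (α * y ^ (A - 1)) y := by
      by_cases hA : A = 0
      · have e : logMain α A = fun x => α * Real.log x := by
          funext x; simp [logMain, hA]
        rw [e]
        refine ((Real.hasDerivAt_log hy0).const_mul α).congr_deriv ?_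
        rw [hA, zero_sub, Real.rpow_neg_one]
      · have e : logMain α A = fun x => α / A * x ^ A := by
          funext x; simp [logMain, hA]
        rw [e]
        refine ((Real.hasDerivAt_rpow_const (p := A) (Or.inl hy0)).const_mul (α / A)).congr_deriv ?_
        field_simp
    refine (h1.sub (((hasDerivAt_id y).const_mul α).mul_const (w ^ (A - 1)))).congr_deriv ?_
    ring
  have hmvt := Convex.norm_image_sub_le_of_norm_hasDerivWithin_le
    (f := fun y => logMain α A y - α * y * w ^ (A - 1))
    (s := Set.Icc (w - T) (w + T)) (C := α * (K * w ^ (A - 2)))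
    (fun y hy => (hd y hy).hasDerivWithinAt)
    (fun y hy => by
      rw [Real.norm_eq_abs, abs_mul, abs_of_pos hα]
      have := h w y hw (abs_le.2 ⟨by linarith [hy.1], by linarith [hy.2]⟩)
      rw [show A - 1 - 1 = A - 2 by ring] at this
      gcongr)
    (convex_Icc _ _) (x := w) (y := x) ⟨by linarith, by linarith⟩
    ⟨by linarith [hx'.1], by linarith [hx'.2]⟩
  rw [Real.norm_eq_abs, Real.norm_eq_abs] at hmvt
  calc _ = |logMain α A x - α * x * w ^ (A - 1) - (logMain α A w - α * w * w ^ (A - 1))| := by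
        congr 1; ring
    _ ≤ _ := hmvt
    _ ≤ α * (K * w ^ (A - 2)) * T := by gcongr
    _ = _ := by ring

lemma relErr_pos {B w : ℝ} (hw : 4 ≤ w) : 0 < relErr B w := by
  have := one_le_log hw
  unfold relErr
  positivity

lemma inv_le_relErr {B w : ℝ} (hw : 4 ≤ w) : 1 / w ≤ relErr B w := by
  have h1 := one_le_log hw
  have hw0 : 0 < w := by linarith
  have h2 : 1 / w ≤ Real.log w / w := by gcongr
  have h3 : 0 ≤ w ^ (1 - B) := by positivity
  unfold relErr
  linarith

/-- The error term at `s = β e^{w + τ}` in terms of `w`. -/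
lemma exists_laplaceErr_le {β : ℝ} (hβ : 0 < β) (A B : ℝ) {T : ℝ} (hT : 0 < T) :
    ∃ K : ℝ, 0 < K ∧ ∀ w τ : ℝ, 2 * (T + |Real.log β| + 4) ≤ w → |τ| ≤ T →
      laplaceErr A B (β * Real.exp (w + τ)) ≤
        K * (β * Real.exp w * w ^ (A - 1) * relErr B w) := by
  refine ⟨Real.exp T * 2 ^ |A - 1| * (4 + 2 ^ |1 - B|), by positivity, fun w τ hw hτ => ?_⟩
  have hτ' := abs_le.1 hτ
  have hb := abs_nonneg (Real.log β)
  have hb1 := le_abs_self (Real.log β)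
  have hb2 := neg_abs_le (Real.log β)
  have hw4 : 4 ≤ w := by linarith
  have hw0 : 0 < w := by linarith
  have hlog : Real.log (β * Real.exp (w + τ)) = Real.log β + (w + τ) := by
    rw [Real.log_mul hβ.ne' (Real.exp_pos _).ne', Real.log_exp]
  set l := Real.log β + (w + τ) with hl
  have hl1 : l ≤ 2 * w := by linarith
  have hl2 : w ≤ 2 * l := by linarith
  have hl0 : 0 < l := by linarith
  have hlw := one_le_log hw4
  have hll : 0 ≤ Real.log l := Real.log_nonneg (by linarith)
  have hlogl : Real.log l ≤ 2 * Real.log w := by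
    have h1 := Real.log_le_log hl0 hl1
    rw [Real.log_mul (by norm_num) hw0.ne'] at h1
    have h2 : Real.log 2 ≤ Real.log w := Real.log_le_log (by norm_num) (by linarith)
    linarith
  have hrel : relErr B l ≤ (4 + 2 ^ |1 - B|) * relErr B w := by
    have h1 : Real.log l / l ≤ 4 * (Real.log w / w) := by
      calc Real.log l / l ≤ 2 * Real.log w / (w / 2) := by
            gcongr
            linarith
        _ = _ := by field_simp; norm_num
    have h2 : l ^ (1 - B) ≤ 2 ^ |1 - B| * w ^ (1 - B) :=
      rpow_le_mul_rpow _ hl0 hw0 (by norm_num) hl1 hl2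
    have h3 : 0 ≤ Real.log w / w := by positivity
    have h4 : 0 ≤ w ^ (1 - B) := by positivity
    have h5 : (0 : ℝ) ≤ 2 ^ |1 - B| := by positivity
    unfold relErr
    nlinarith [mul_nonneg h5 h3]
  have hrl : 0 ≤ relErr B l := by
    unfold relErr; positivity
  rw [laplaceErr, hlog, Real.exp_add]
  calc β * (Real.exp w * Real.exp τ) * l ^ (A - 1) * relErr B l
      ≤ β * (Real.exp w * Real.exp T) * (2 ^ |A - 1| * w ^ (A - 1)) *
        ((4 + 2 ^ |1 - B|) * relErr B w) := by
        gcongr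
        · exact hτ'.2
        · exact rpow_le_mul_rpow _ hl0 hw0 (by norm_num) hl1 hl2
    _ = _ := by ring

/-- The exponent `log E e^{sS} - s V` at `s = β e^{w + τ}`, up to a relative error, is
`M e^τ (τ + η)` with `M = α β e^w w^{A-1}`. -/
lemma IsWeightSequence.exists_exponent_asymptotic {q : ℕ+ → ℝ} {α β A B : ℝ}
    (hq : IsWeightSequence q α β A B) {CA D c₃ : ℝ}
    (hCA : Tendsto (fun y => harmonicSum q y - harmonicMain α β A y) atTop (𝓝 CA))
    (hc₃ : 0 < c₃) {T : ℝ} (hT : 0 < T) :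
    ∃ K w₀ : ℝ, 0 < K ∧ ∀ (g : ℕ+ → ℝ → ℝ) (gl : ℝ → ℝ), CumulantBounds g gl D c₃ →
      ∀ w τ s Q V : ℝ, w₀ ≤ w → |τ| ≤ T → s = β * Real.exp (w + τ) →
        s * Real.log s ≤ Q → logMain α A w = V - CA →
        |∑ n ∈ hq.upTo Q, g n (s / q n) - s * V -
          α * β * Real.exp w * w ^ (A - 1) * (Real.exp τ * (τ + etaOf gl))| ≤
          K * (α * β * Real.exp w * w ^ (A - 1) * relErr B w) := by
  have hα := hq.alpha_pos
  have hβ := hq.beta_pos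
  obtain ⟨K₁, s₁, hK₁, h₁⟩ := hq.exists_laplace_asymptotic (D := D) hCA hc₃
  obtain ⟨K₂, hK₂, h₂⟩ := exists_laplaceErr_le hβ A B hT
  obtain ⟨K₃, hK₃, h₃⟩ := exists_logMain_sub_le (A := A) hα hT
  obtain ⟨K₄, hK₄, h₄⟩ := exists_rpow_sub_le (A - 1) hT
  have hexp : ∀ᶠ w : ℝ in atTop, s₁ ≤ β * Real.exp (w + -T) :=
    ((Real.tendsto_exp_atTop.comp
      (tendsto_atTop_add_const_right _ (-T) tendsto_id)).const_mul_atTop hβ).eventually_ge_atTop s₁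
  obtain ⟨w₁, hw₁⟩ := eventually_atTop.1 hexp
  refine ⟨K₁ * K₂ / α + Real.exp T * K₃ / α + Real.exp T * K₄ * (1 + |D|),
    max w₁ (2 * (T + |Real.log β| + 4)), by positivity,
    fun g gl hg w τ s Q V hw hτ hs hQ hV => ?_⟩
  have hw1 := (le_max_left _ _).trans hw
  have hw2 := (le_max_right _ _).trans hw
  have hb := abs_nonneg (Real.log β)
  have hw4 : 4 ≤ w := by linarith
  have hw0 : 0 < w := by linarith
  have hτ' := abs_le.1 hτ
  have hs1 : s₁ ≤ s := by
    rw [hs]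
    refine (hw₁ w hw1).trans ?_
    gcongr
    linarith [hτ'.1]
  have hs0 : 0 < s := by rw [hs]; positivity
  have hlogs : Real.log (s / β) = w + τ := by
    rw [hs, mul_div_cancel_left₀ _ hβ.ne', Real.log_exp]
  have hmain : harmonicMain α β A s = logMain α A (w + τ) := by
    rw [hs, harmonicMain_mul_exp hβ]
  have e1 := h₁ g gl hg s Q hs1 hQ
  rw [hlogs, hmain] at e1
  have e2 := h₂ w τ hw2 hτ
  rw [← hs] at e2
  have e3 := h₃ w (w + τ) (by linarith) (by simpa using hτ)
  have e4 := h₄ w (w + τ) (by linarith) (by simpa using hτ)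
  rw [add_sub_cancel_left] at e3
  have hη : |etaOf gl| ≤ 1 + |D| := hg.abs_etaOf_le.trans (by linarith [le_abs_self D])
  set M := α * β * Real.exp w * w ^ (A - 1) with hM
  have hM0 : 0 < M := by positivity
  have hr0 := relErr_pos (B := B) hw4
  have hwA : w ^ (A - 2) ≤ w ^ (A - 1) * relErr B w := by
    have : w ^ (A - 2) = w ^ (A - 1) * (1 / w) := by
      rw [mul_one_div, ← Real.rpow_sub_one hw0.ne']; ring_nf
    rw [this]
    gcongr
    exact inv_le_relErr hw4
  have hsT : s ≤ β * Real.exp w * Real.exp T := by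
    rw [hs, Real.exp_add, ← mul_assoc]
    gcongr
    exact hτ'.2
  have hMs : α * w ^ (A - 1) * s = M * Real.exp τ := by
    rw [hs, Real.exp_add, hM]; ring
  have f1 : K₁ * laplaceErr A B s ≤ K₁ * K₂ / α * (M * relErr B w) := by
    calc _ ≤ K₁ * (K₂ * (β * Real.exp w * w ^ (A - 1) * relErr B w)) := by gcongr
      _ = _ := by rw [hM]; field_simp
  have f3 : |s * (logMain α A (w + τ) - logMain α A w - α * τ * w ^ (A - 1))| ≤
      Real.exp T * K₃ / α * (M * relErr B w) := by
    rw [abs_mul, abs_of_pos hs0]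
    calc _ ≤ (β * Real.exp w * Real.exp T) * (K₃ * (w ^ (A - 1) * relErr B w)) := by
          gcongr
          exact e3.trans (by gcongr)
      _ = _ := by rw [hM]; field_simp
  have f4 : |α * s * etaOf gl * ((w + τ) ^ (A - 1) - w ^ (A - 1))| ≤
      Real.exp T * K₄ * (1 + |D|) * (M * relErr B w) := by
    rw [show A - 1 - 1 = A - 2 by ring] at e4
    rw [abs_mul, abs_mul, abs_of_pos (by positivity : 0 < α * s)]
    calc _ ≤ α * (β * Real.exp w * Real.exp T) * (1 + |D|) *
          (K₄ * (w ^ (A - 1) * relErr B w)) := by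
          gcongr
          exact e4.trans (by gcongr)
      _ = _ := by rw [hM]; ring
  have hid : ∑ n ∈ hq.upTo Q, g n (s / q n) - s * V - M * (Real.exp τ * (τ + etaOf gl)) =
      (∑ n ∈ hq.upTo Q, g n (s / q n) - s * (logMain α A (w + τ) + CA) -
        α * (w + τ) ^ (A - 1) * s * etaOf gl) +
      s * (logMain α A (w + τ) - logMain α A w - α * τ * w ^ (A - 1)) +
      α * s * etaOf gl * ((w + τ) ^ (A - 1) - w ^ (A - 1)) := by
    rw [hV, ← mul_assoc M, ← hMs]; ring
  rw [hid, add_mul, add_mul]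
  refine (abs_add_le _ _).trans (add_le_add ((abs_add_le _ _).trans (add_le_add ?_ f3)) f4)
  exact e1.trans f1

lemma half_sq_le_one_add_exp_mul {κ : ℝ} (h0 : 0 ≤ κ) (h1 : κ ≤ 1) :
    κ ^ 2 / 2 ≤ 1 + Real.exp κ * (κ - 1) := by
  have h := Real.exp_bound' h0 h1 (n := 3) (by norm_num)
  simp [Finset.sum_range_succ, Nat.factorial] at h
  have h2 : Real.exp κ ≤ 1 + κ + κ ^ 2 / 2 + 2 / 9 * κ ^ 3 := by linarith
  have h3 : Real.exp κ * (1 - κ) ≤ (1 + κ + κ ^ 2 / 2 + 2 / 9 * κ ^ 3) * (1 - κ) := by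
    apply mul_le_mul_of_nonneg_right h2; linarith
  have h4 : 0 ≤ κ ^ 3 := by positivity
  have h5 : 0 ≤ κ ^ 4 := by positivity
  nlinarith

lemma half_sq_le_exp_mul {κ : ℝ} (h0 : 0 ≤ κ) :
    κ ^ 2 / 2 ≤ Real.exp κ * (Real.exp κ - 1 - κ) := by
  have h1 := Real.quadratic_le_exp_of_nonneg h0
  have h2 := Real.one_le_exp h0
  have h3 : 0 ≤ κ ^ 2 / 2 := by positivity
  nlinarith

lemma exp_mul_one_add_le {κ : ℝ} (h0 : 0 ≤ κ) (h1 : κ ≤ 1) :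
    Real.exp κ * (1 + κ) ≤ 1 + 5 * κ := by
  have h := (abs_le.1 (Real.abs_exp_sub_one_sub_id_le (abs_le.2 ⟨by linarith, h1⟩))).2
  have h2 : Real.exp κ ≤ 1 + 2 * κ := by nlinarith
  nlinarith

/-- The large deviation estimate. If `log E e^{sS} - s V` is `M e^τ (τ + η)` at `s = σ e^τ`, with
relative error `δ`, then `P(S > V)` is `exp (-M e^{-η-1})`, up to a relative error of order `√δ`
in the exponent. The exponent is minimal at `τ = -η - 1`; the lower bound tilts at a distance
`κ` of order `√δ` from there. -/
lemma exists_prob_eq_exp {Ω : Type*} [MeasurableSpace Ω] {P : Measure Ω} [IsProbabilityMeasure P]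
    {S : Ω → ℝ} (hS : Measurable S) (hi : ∀ s, Integrable (fun ω => Real.exp (s * S ω)) P)
    {σ V M η δ K T : ℝ} (hσ : 0 < σ) (hM : 0 < M) (hδ : 0 < δ) (hδ1 : δ ≤ 1) (hK : 0 < K)
    (hT : |η| + 3 ≤ T)
    (h : ∀ τ : ℝ, |τ| ≤ T → |cgf S P (σ * Real.exp τ) - σ * Real.exp τ * V -
      M * (Real.exp τ * (τ + η))| ≤ K * (M * δ))
    (hκ : 2 * Real.exp T * (2 * K + 1) * δ ≤ 1) (hMδ : Real.log 4 ≤ M * δ) :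
    ∃ ε : ℝ, |ε| ≤ (5 * Real.sqrt (2 * Real.exp T * (2 * K + 1)) + (K + 1) * Real.exp T) *
        Real.sqrt δ ∧
      P.real {ω | V < S ω} = Real.exp (-(M * Real.exp (-η - 1) * (1 + ε))) := by
  set E := Real.exp (-η - 1) with hE
  have hE0 : 0 < E := Real.exp_pos _
  have hηa := abs_nonneg η
  have hη1 := le_abs_self η
  have hη2 := neg_abs_le η
  have hEinv : E⁻¹ ≤ Real.exp T := by
    rw [hE, ← Real.exp_neg]
    apply Real.exp_le_exp.2
    linarith
  -- This makes the gain `E κ²/2` exceed the error `2 K δ` by `δ`.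
  set κ := Real.sqrt (2 * E⁻¹ * (2 * K + 1) * δ) with hκd
  have hκsq : κ ^ 2 = 2 * E⁻¹ * (2 * K + 1) * δ := Real.sq_sqrt (by positivity)
  have hκ0 : 0 ≤ κ := Real.sqrt_nonneg _
  have hκ1 : κ ≤ 1 := by
    rw [hκd, Real.sqrt_le_one]
    refine le_trans ?_ hκ
    gcongr
  have hκle : κ ≤ Real.sqrt (2 * Real.exp T * (2 * K + 1)) * Real.sqrt δ := by
    rw [← Real.sqrt_mul (by positivity), hκd]
    apply Real.sqrt_le_sqrt
    gcongr
  have hgain : E * (κ ^ 2 / 2) = (2 * K + 1) * δ := by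
    rw [hκsq]; field_simp
  set x := Real.exp κ with hx
  have hx1 : 1 ≤ x := Real.one_le_exp hκ0
  have hτ1 : Real.exp (-η - 1 + κ) = E * x := by rw [Real.exp_add]
  have hτ2 : Real.exp (-η - 1 + 2 * κ) = E * (x * x) := by
    rw [Real.exp_add, two_mul, Real.exp_add]
  have b0 := abs_le.1 (h (-η - 1) (abs_le.2 ⟨by linarith, by linarith⟩))
  have b1 := abs_le.1 (h (-η - 1 + κ) (abs_le.2 ⟨by linarith, by linarith⟩))
  have b2 := abs_le.1 (h (-η - 1 + 2 * κ) (abs_le.2 ⟨by linarith, by linarith⟩))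
  rw [← hE, show M * (E * (-η - 1 + η)) = -(M * E) by ring] at b0
  rw [hτ1, show M * (E * x * (-η - 1 + κ + η)) = M * (E * x) * (κ - 1) by ring] at b1
  rw [hτ2, show M * (E * (x * x) * (-η - 1 + 2 * κ + η)) =
    M * (E * (x * x)) * (2 * κ - 1) by ring] at b2
  have hs0 : 0 < σ * E := by positivity
  set s₀ := σ * E with hs0d
  set s₁ := σ * (E * x) with hs1d
  set s₂ := σ * (E * (x * x)) with hs2d
  -- With this shift of `V` the minimum of the exponent moves to `τ = -η - 1 + 2κ`.
  set v := 2 * κ * M / σ with hv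
  have hs1v : s₁ * v = 2 * κ * (M * (E * x)) := by rw [hs1d, hv]; field_simp
  have hs2v : s₂ * v = 2 * κ * (M * (E * (x * x))) := by rw [hs2d, hv]; field_simp
  have g1 := mul_le_mul_of_nonneg_left (half_sq_le_one_add_exp_mul hκ0 hκ1) hE0.le
  have g2 := mul_le_mul_of_nonneg_left (half_sq_le_exp_mul hκ0) hE0.le
  have g3 := exp_mul_one_add_le hκ0 hκ1
  rw [hgain, ← hx] at g1 g2
  rw [← hx] at g3
  have G1 : (2 * K + 1) * (M * δ) ≤ M * E + M * (E * x) * (κ - 1) := by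
    have := mul_le_mul_of_nonneg_left g1 hM.le
    linarith only [this]
  have G2 : (2 * K + 1) * (M * δ) ≤ M * (E * (x * x)) - M * (E * x) * (1 + κ) := by
    have := mul_le_mul_of_nonneg_left g2 hM.le
    linarith only [this]
  have G3 : M * (E * x) * (1 + κ) ≤ M * E * (1 + 5 * κ) := by
    have := mul_le_mul_of_nonneg_left g3 (mul_pos hM hE0).le
    linarith only [this]
  have hupper := measureReal_lt_le_exp hi (V := V) hs0.le
  have h01 : s₀ ≤ s₁ :=
    mul_le_mul_of_nonneg_left (le_mul_of_one_le_right hE0.le hx1) hσ.le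
  have h12 : s₁ ≤ s₂ := mul_le_mul_of_nonneg_left (mul_le_mul_of_nonneg_left
    (le_mul_of_one_le_right (by linarith) hx1) hE0.le) hσ.le
  have hlower := le_measureReal_of_tilting hS hi (s₀ := s₀) (s₁ := s₁) (s₂ := s₂) (V := V)
    (V₂ := V + v) (by positivity) h01 h12
    (by linarith only [b0.2, b1.1, G1, hMδ])
    (by
      rw [mul_add, mul_add, hs1v, hs2v]
      linarith only [b2.2, b1.1, G2, hMδ])
  set p := P.real {ω | V < S ω} with hp
  have hp0 : 0 < p := lt_of_lt_of_le (by positivity) hlower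
  have hlogu : Real.log p ≤ cgf S P s₀ - s₀ * V := by
    rw [Real.log_le_iff_le_exp hp0]; exact hupper
  have hlogl : cgf S P s₁ - s₁ * (V + v) - Real.log 2 ≤ Real.log p := by
    rw [Real.le_log_iff_exp_le hp0, Real.exp_sub, Real.exp_log (by norm_num)]
    exact hlower
  have hlog2 : Real.log 2 ≤ M * δ :=
    (Real.log_le_log (by norm_num) (by norm_num)).trans hMδ
  have hME : 0 < M * E := by positivity
  refine ⟨-Real.log p / (M * E) - 1, ?_, ?_⟩
  · have hsd : δ ≤ Real.sqrt δ := by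
      rw [Real.le_sqrt' hδ]
      exact pow_le_of_le_one hδ.le hδ1 two_ne_zero
    have hbound : |-Real.log p / (M * E) - 1| ≤ 5 * κ + (K + 1) * E⁻¹ * δ := by
      have e : -Real.log p / (M * E) - 1 = (-Real.log p - M * E) / (M * E) := by
        field_simp
      have e2 : (5 * κ + (K + 1) * E⁻¹ * δ) * (M * E) =
          5 * κ * (M * E) + (K + 1) * (M * δ) := by
        field_simp
      rw [e, abs_div, abs_of_pos hME, div_le_iff₀ hME, e2, abs_le]
      have hp5 : 0 ≤ 5 * κ * (M * E) := by positivity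
      have hMd : 0 < M * δ := by positivity
      constructor
      · linarith only [b0.2, hlogu, hp5, hMd]
      · rw [mul_add, hs1v] at hlogl
        linarith only [b1.1, hlogl, hlog2, G3]
    refine hbound.trans ?_
    rw [add_mul]
    have : (K + 1) * E⁻¹ * δ ≤ (K + 1) * Real.exp T * Real.sqrt δ := by gcongr
    linarith
  · rw [show M * E * (1 + (-Real.log p / (M * E) - 1)) = -Real.log p by field_simp; ring, neg_neg,
      Real.exp_log hp0]

lemma tendsto_relErr {B : ℝ} (hB : 1 < B) : Tendsto (relErr B) atTop (𝓝 0) := by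
  have h1 : Tendsto (fun w : ℝ => Real.log w / w) atTop (𝓝 0) := by
    have := (isLittleO_log_rpow_atTop (r := 1) one_pos).tendsto_div_nhds_zero
    simpa using this
  have h2 : Tendsto (fun w : ℝ => w ^ (1 - B)) atTop (𝓝 0) := by
    have := tendsto_rpow_neg_atTop (y := B - 1) (by linarith)
    simpa using this
  have h3 := h1.add h2
  rw [add_zero] at h3
  exact h3

lemma sqrt_relErr_le {B w : ℝ} (hw : 4 ≤ w) :
    Real.sqrt (relErr B w) ≤
      Real.sqrt (Real.log w) / w ^ (1 / 2 : ℝ) + 1 / w ^ ((B - 1) / 2) := by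
  have hw0 : 0 < w := by linarith
  have hl := one_le_log hw
  have e1 : Real.sqrt (Real.log w / w) = Real.sqrt (Real.log w) / w ^ (1 / 2 : ℝ) := by
    rw [Real.sqrt_div (by linarith), Real.sqrt_eq_rpow w]
  have e2 : Real.sqrt (w ^ (1 - B)) = 1 / w ^ ((B - 1) / 2) := by
    rw [Real.sqrt_eq_rpow, ← Real.rpow_mul hw0.le, one_div (w ^ _), ← Real.rpow_neg hw0.le]
    congr 1; ring
  rw [← e1, ← e2, relErr]
  simp only [Real.sqrt_eq_rpow]
  exact Real.rpow_add_le_add_rpow (by positivity) (by positivity) (by norm_num) (by norm_num)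

/-- The range of `W` in the theorem guarantees `s log s ≤ Q` at `s = β e^{w + τ}`. -/
lemma mul_log_le_of_le {β T w τ Q : ℝ} (hβ : 0 < β) (hT : 0 < T)
    (hw : 2 * (T + |Real.log β| + 4) ≤ w) (hτ : |τ| ≤ T) (hQ : 3 ≤ Q)
    (hwQ : w ≤ Real.log Q - Real.log (Real.log Q) - (T + |Real.log (2 * β)| + 1)) :
    β * Real.exp (w + τ) * Real.log (β * Real.exp (w + τ)) ≤ Q := by
  have hQ0 : 0 < Q := by linarith
  have hlQ : 1 ≤ Real.log Q := by
    rw [Real.le_log_iff_exp_le hQ0]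
    linarith [Real.exp_one_lt_d9]
  have hllQ : 0 ≤ Real.log (Real.log Q) := Real.log_nonneg hlQ
  have hτ' := (abs_le.1 hτ).2
  have hb := abs_nonneg (Real.log β)
  have hb1 := le_abs_self (Real.log β)
  have hb' := abs_nonneg (Real.log (2 * β))
  have hb2 := le_abs_self (Real.log (2 * β))
  have hl : Real.log (β * Real.exp (w + τ)) ≤ 2 * Real.log Q := by
    rw [Real.log_mul hβ.ne' (Real.exp_pos _).ne', Real.log_exp]
    linarith
  have hmain : 2 * β * Real.exp (w + τ) * Real.log Q ≤ Q := by
    have e : 2 * β * Real.exp (w + τ) * Real.log Q =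
        Real.exp (Real.log (2 * β) + (w + τ) + Real.log (Real.log Q)) := by
      rw [Real.exp_add (_ + _) (Real.log (Real.log Q)), Real.exp_add (Real.log (2 * β)),
        Real.exp_log (by positivity), Real.exp_log (show 0 < Real.log Q by linarith)]
    rw [e]
    calc _ ≤ Real.exp (Real.log Q) := Real.exp_le_exp.2 (by linarith)
      _ = Q := Real.exp_log hQ0
  calc _ ≤ β * Real.exp (w + τ) * (2 * Real.log Q) := by gcongr
    _ = 2 * β * Real.exp (w + τ) * Real.log Q := by ring
    _ ≤ Q := hmain

section WeightedSum

variable {Ω : Type*} [MeasurableSpace Ω] {P : Measure Ω} {Y : ℕ+ → Ω → ℝ} {q : ℕ+ → ℝ}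

lemma cgf_div (n : ℕ+) (s : ℝ) :
    cgf (fun ω => Y n ω / q n) P s = cgf (Y n) P (s / q n) := by
  simp only [cgf, mgf]
  congr 2
  funext ω
  congr 1
  ring

lemma integrable_exp_mul_div [IsProbabilityMeasure P] (hm : ∀ n, Measurable (Y n))
    (hb : ∀ n, ∀ᵐ ω ∂P, Y n ω ∈ Set.Icc (-1 : ℝ) 1) (n : ℕ+) (s : ℝ) :
    Integrable (fun ω => Real.exp (s * (Y n ω / q n))) P := by
  refine (integrable_exp_mul_of_bounded (hm n).aemeasurable (hb n) (s / q n)).congr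
    (Eventually.of_forall fun ω => ?_)
  simp only
  congr 1
  ring

lemma cgf_weighted_sum [IsProbabilityMeasure P] (hm : ∀ n, Measurable (Y n)) (hind : iIndepFun Y P)
    (hb : ∀ n, ∀ᵐ ω ∂P, Y n ω ∈ Set.Icc (-1 : ℝ) 1) (F : Finset ℕ+) (s : ℝ) :
    Integrable (fun ω => Real.exp (s * ∑ n ∈ F, Y n ω / q n)) P ∧
      cgf (fun ω => ∑ n ∈ F, Y n ω / q n) P s = ∑ n ∈ F, cgf (Y n) P (s / q n) := by
  have hind' : iIndepFun (fun n ω => Y n ω / q n) P :=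
    hind.comp (fun n y => y / q n) fun n => by fun_prop
  have hm' : ∀ n, Measurable (fun ω => Y n ω / q n) := fun n => (hm n).div_const _
  have e : (∑ n ∈ F, fun ω => Y n ω / q n) = fun ω => ∑ n ∈ F, Y n ω / q n := by
    funext ω; simp
  have h1 := hind'.integrable_exp_mul_sum (t := s) hm' (s := F)
    fun n _ => integrable_exp_mul_div hm hb n s
  have h2 := hind'.cgf_sum (t := s) hm' (s := F) fun n _ => integrable_exp_mul_div hm hb n s
  rw [e] at h1 h2
  refine ⟨h1, ?_⟩
  rw [h2]
  exact Finset.sum_congr rfl fun n _ => cgf_div n s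

end WeightedSum

end LargeDev

theorem theorem1p1 (q : ℕ+ → ℝ) (α β A B : ℝ) (hq : LargeDev.IsWeightSequence q α β A B) :
    ∃ CA : ℝ,
      Tendsto (fun y => LargeDev.harmonicSum q y - LargeDev.harmonicMain α β A y) atTop (𝓝 CA) ∧
      ∀ c₁ c₂ c₃ : ℝ, 0 < c₁ → 0 < c₂ → 0 < c₃ →
        ∃ c Θ K Q₀ : ℝ, 1 ≤ c ∧ 0 < Θ ∧ 0 < K ∧ 1 < Q₀ ∧
          ∀ {Ω Ω' : Type*} [MeasurableSpace Ω] [MeasurableSpace Ω']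
            (P : Measure Ω) [IsProbabilityMeasure P] (P' : Measure Ω') [IsProbabilityMeasure P']
            (Y : ℕ+ → Ω → ℝ) (Ylim : Ω' → ℝ),
            LargeDev.CRVH P P' Y Ylim c₁ c₂ c₃ →
            IntegrableOn (fun u => LargeDev.f P' Ylim u / u ^ 2) (Set.Ioi 0) ∧
            ∀ Q V W : ℝ, Q₀ ≤ Q → 1 + CA ≤ V → W = LargeDev.W α A CA V →
              c ≤ W → W ≤ Real.log Q - Real.log (Real.log Q) - Θ →
              ∃ ε : ℝ,
                |ε| ≤ K * (Real.sqrt (Real.log W) / W ^ (1 / 2 : ℝ)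
                  + 1 / W ^ ((B - 1) / 2)) ∧
                LargeDev.Phi P q Y Q V =
                  Real.exp (-(α * β * Real.exp (-LargeDev.eta P' Ylim - 1) * W ^ (A - 1)
                    * Real.exp W * (1 + ε))) := by
  have hα := hq.alpha_pos
  have hβ := hq.beta_pos
  have hA := hq.A_nonneg
  obtain ⟨CA, -, -, hCA, -⟩ := hq.exists_harmonicSum_limit
  refine ⟨CA, hCA, fun c₁ c₂ c₃ hc₁ hc₂ hc₃ => ?_⟩
  set D : ℝ := 4 + 16 * |Real.log c₂| + 32 * c₁ with hD
  have hD0 : 0 < D := by positivity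
  -- As `|η| ≤ 1 + D`, the tilting parameters `-η - 1 + 2κ` with `κ ≤ 1` lie in `[-T, T]`.
  set T : ℝ := D + 4 with hT
  have hT0 : 0 < T := by positivity
  obtain ⟨K, w₀, hK, h⟩ := hq.exists_exponent_asymptotic (D := D) hCA hc₃ hT0
  have hrel : ∀ᶠ w in atTop, LargeDev.relErr B w < 1 / (2 * Real.exp T * (2 * K + 1)) :=
    (LargeDev.tendsto_relErr hq.one_lt_B).eventually (gt_mem_nhds (by positivity))
  have hbig : ∀ᶠ w : ℝ in atTop, Real.log 4 / (α * β) ≤ Real.exp w / w ^ (2 : ℝ) :=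
    (tendsto_exp_div_rpow_atTop 2).eventually_ge_atTop _
  obtain ⟨w₁, hw₁⟩ := eventually_atTop.1 (hrel.and hbig)
  refine ⟨max (max w₀ w₁) (2 * (T + |Real.log β| + 4)), T + |Real.log (2 * β)| + 1,
    5 * Real.sqrt (2 * Real.exp T * (2 * K + 1)) + (K + 1) * Real.exp T, 3, ?_, by positivity,
    by positivity, by norm_num, ?_⟩
  · refine le_trans ?_ (le_max_right _ _)
    have := abs_nonneg (Real.log β)
    linarith
  intro Ω Ω' _ _ P _ P' _ Y Ylim hY
  have hg := hY.cumulantBounds hc₁ hc₂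
  refine ⟨by rw [LargeDev.f_eq_excess]; exact hg.integrableOn_excess, ?_⟩
  intro Q V W hQ hV hW hcW hWQ
  have hw0 : w₀ ≤ W := (le_max_left _ _).trans ((le_max_left _ _).trans hcW)
  have hw1 : w₁ ≤ W := (le_max_right _ _).trans ((le_max_left _ _).trans hcW)
  have hw2 : 2 * (T + |Real.log β| + 4) ≤ W := (le_max_right _ _).trans hcW
  have hb := abs_nonneg (Real.log β)
  have hW4 : 4 ≤ W := by linarith
  have hW0 : 0 < W := by linarith
  obtain ⟨hrelW, hbigW⟩ := hw₁ W hw1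
  have hr0 := LargeDev.relErr_pos (B := B) hW4
  have hmain : LargeDev.logMain α A W = V - CA := by
    rw [hW]; exact LargeDev.logMain_W hα hA hV
  set S : Ω → ℝ := fun ω => ∑ n ∈ hq.upTo Q, Y n ω / q n with hS
  have hSm : Measurable S := Finset.measurable_fun_sum _ fun n _ => (hY.measurable n).div_const _
  have hsum := LargeDev.cgf_weighted_sum (q := q) hY.measurable hY.indep hY.supported (hq.upTo Q)
  set M : ℝ := α * β * Real.exp W * W ^ (A - 1) with hM
  have hM0 : 0 < M := by positivity
  have hκ : 2 * Real.exp T * (2 * K + 1) * LargeDev.relErr B W ≤ 1 := by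
    have := hrelW.le
    rw [le_div_iff₀ (by positivity)] at this
    linarith
  have h2K : 1 ≤ 2 * Real.exp T * (2 * K + 1) := by
    have := Real.one_le_exp hT0.le
    nlinarith
  have hMδ : Real.log 4 ≤ M * LargeDev.relErr B W := by
    rw [div_le_iff₀ (by positivity)] at hbigW
    have hWA : W ^ (-1 : ℝ) ≤ W ^ (A - 1) :=
      Real.rpow_le_rpow_of_exponent_le (by linarith) (by linarith)
    have hinv := LargeDev.inv_le_relErr (B := B) hW4
    calc Real.log 4 ≤ Real.exp W / W ^ (2 : ℝ) * (α * β) := hbigW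
      _ = α * β * Real.exp W * W ^ (-1 : ℝ) * (1 / W) := by
          rw [Real.rpow_neg_one, Real.rpow_two]; field_simp
      _ ≤ _ := by rw [hM]; gcongr
  have hηT : |LargeDev.etaOf (cgf Ylim P')| + 3 ≤ T := by
    linarith [hg.abs_etaOf_le]
  obtain ⟨ε, hε, hP⟩ := LargeDev.exists_prob_eq_exp (V := V) (σ := β * Real.exp W) hSm
    (fun s => (hsum s).1) (by positivity) hM0 hr0 (by nlinarith) hK hηT (fun τ hτ => by
      rw [(hsum _).2]
      have e : β * Real.exp W * Real.exp τ = β * Real.exp (W + τ) := by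
        rw [Real.exp_add, mul_assoc]
      rw [e]
      exact h _ _ hg W τ _ Q V hw0 hτ rfl
        (LargeDev.mul_log_le_of_le hβ hT0 hw2 hτ hQ hWQ) hmain) hκ hMδ
  refine ⟨ε, hε.trans ?_, ?_⟩
  · gcongr
    exact LargeDev.sqrt_relErr_le hW4
  · have hPhi : LargeDev.Phi P q Y Q V = P.real {ω | V < S ω} := by
      unfold LargeDev.Phi
      congr 1
      ext ω
      simp only [hS, hq.finsum_eq_sum]
    have hη : LargeDev.eta P' Ylim = LargeDev.etaOf (cgf Ylim P') := rfl
    rw [hPhi, hP, hη, hM]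
    congr 1
    ring
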